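/- **Theorem (Universal properties of spans).** Let $\mathcal{E}$ be a category with chosen pullbacks and let $\mathscr{C}$ be a bicategory. Let $\mathbf{Span}(\mathcal{E})$ be the bicategory with the objects of $\mathcal{E}$, with spans $X\leftarrow T\to Y$ as 1-cells (composed by the chosen pullbacks), and with morphisms of spans as 2-cells. Let $(-)_\Sigma\colon\mathcal{E}\to\mathbf{Span}(\mathcal{E})$ be the pseudofunctor (with $\mathcal{E}$ regarded as a locally discrete 2-category) that is the identity on objects and sends $f\colon X\to Y$ to the span $X\xleftarrow{1_X}X\xrightarrow{f}Y$. An *icon* $\alpha\colon F\Rightarrow G$ between oplax functors (in particular, pseudofunctors) $F,G\colon\mathscr{A}\to\mathscr{C}$ which agree on objects is a family of natural transformations $F_{X,Y}\Rightarrow G_{X,Y}\colon\mathscr{A}(X,Y)\to\mathscr{C}(FX,FY)$ compatible with the binary and nullary oplax constraints. An oplax functor $F$ is *gregarious* if its unit constraints $F1_X\to 1_{FX}$ are invertible and its constraint $F(gf)\to Fg\cdot Ff$ is invertible for all composable 1-cells $f,g$ such that $g$ has a right adjoint. A pseudofunctor $F\colon\mathcal{E}\to\mathscr{C}$ is *sinister*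 if $Ff$ has a right adjoint for every morphism $f$ of $\mathcal{E}$. A sinister $F$ satisfies the *Beck condition* if for every pullback square $gf'=fg'$ in $\mathcal{E}$ the mate $Ff'\cdot(Fg')^{*}\to(Fg)^{*}\cdot Ff$ of the isomorphism $Fg\cdot Ff'\cong Ff\cdot Fg'$ is invertible, where $(-)^{*}$ denotes a right adjoint. Write $\mathbf{Greg}(\mathbf{Span}(\mathcal{E}),\mathscr{C})$ for the category of gregarious functors and icons, $\mathbf{Icon}(\mathbf{Span}(\mathcal{E}),\mathscr{C})$ for the category of pseudofunctors and icons, $\mathbf{Sin}(\mathcal{E},\mathscr{C})$ for the category of sinister pseudofunctors and invertible icons, and $\mathbf{Beck}(\mathcal{E},\mathscr{C})$ for its full subcategory on those satisfying the Beck condition. Then composition with $(-)_\Sigma$ defines an equivalence of categories $$\mathbf{Greg}(\mathbf{Span}(\mathcal{E}),\mathscr{C})\simeq\mathbf{Sin}(\mathcal{E},\mathscr{C}),$$ and this restricts to an equivalence of categories $$\mathbf{Icon}(\mathbf{Span}(\mathcal{E}),\mathscr{C})\simeq\mathbf{Beck}(\mathcal{E},\mathscr{C}).$$ -/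

import Mathlib

open CategoryTheory Bicategory Limits

attribute [-instance] CategoryTheory.instCategoryEndMonoidal

universe w₁ w₂ w₃ v v₁ v₂ v₃ u u₁ u₂ u₃

namespace SpanUP

/-! ### The bicategory of spans -/

noncomputable section Span

/-- A category with chosen pullbacks: every cospan is equipped with a pullback of it. -/
class PullbackChoice (E : Type u) [Category.{v} E] where
  /-- the chosen pullback of a cospan -/
  pb {X Y Z : E} (f : X ⟶ Z) (g : Y ⟶ Z) : ChosenPullback f g

variable {E : Type u} [Category.{v} E]

/-- The type of spans `X ⟵ apex ⟶ Y` in `E`. Its morphisms (the 2-cells) are the morphisms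
between the apices that commute with the legs. -/
abbrev Sp (X Y : E) := Span (⊤ : MorphismProperty E) (⊤ : MorphismProperty E) X Y

/-- The span `X ⟵ T ⟶ Y` with legs `s` and `t`. -/
abbrev Sp.mk {X Y T : E} (s : T ⟶ X) (t : T ⟶ Y) : Sp X Y := ⟨T, s, t, trivial, trivial⟩

variable [PullbackChoice E]

/-- The chosen pullback of `f` and `g`. -/
abbrev pb {X Y Z : E} (f : X ⟶ Z) (g : Y ⟶ Z) : ChosenPullback f g := PullbackChoice.pb f g

/-- The morphism into the chosen pullback given by the universal property. -/
abbrev plift {X Y Z A : E} {f : X ⟶ Z} {g : Y ⟶ Z} (a : A ⟶ X) (b : A ⟶ Y)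
    (h : a ≫ f = b ≫ g) : A ⟶ (pb f g).pullback := (pb f g).isPullback.lift a b h

namespace Sp

/-- Composition of spans by the chosen pullback. -/
abbrev comp {X Y Z : E} (S : Sp X Y) (T : Sp Y Z) : Sp X Z :=
  Sp.mk ((pb S.r T.l).p₁ ≫ S.l) ((pb S.r T.l).p₂ ≫ T.r)

@[simps]
def whiskerLeft {X Y Z : E} (S : Sp X Y) {T T' : Sp Y Z} (η : T ⟶ T') :
    S.comp T ⟶ S.comp T' where
  hom := plift (pb S.r T.l).p₁ ((pb S.r T.l).p₂ ≫ η.hom) (by simp)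

@[simps]
def whiskerRight {X Y Z : E} {S S' : Sp X Y} (η : S ⟶ S') (T : Sp Y Z) :
    S.comp T ⟶ S'.comp T where
  hom := plift ((pb S.r T.l).p₁ ≫ η.hom) (pb S.r T.l).p₂ (by simp)

@[simps]
def associator {W X Y Z : E} (S : Sp W X) (T : Sp X Y) (U : Sp Y Z) :
    (S.comp T).comp U ≅ S.comp (T.comp U) where
  hom.hom := plift ((pb (S.comp T).r U.l).p₁ ≫ (pb S.r T.l).p₁)
    (plift ((pb (S.comp T).r U.l).p₁ ≫ (pb S.r T.l).p₂) (pb (S.comp T).r U.l).p₂ (by simp))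
    (by simp)
  hom.hom_l := by simp
  hom.hom_r := by simp
  inv.hom := plift
    (plift (pb S.r (T.comp U).l).p₁ ((pb S.r (T.comp U).l).p₂ ≫ (pb T.r U.l).p₁) (by simp))
    ((pb S.r (T.comp U).l).p₂ ≫ (pb T.r U.l).p₂) (by simp)
  inv.hom_l := by simp
  inv.hom_r := by simp
  hom_inv_id := by
    apply Span.hom_ext
    apply ChosenPullback.hom_ext
    · apply ChosenPullback.hom_ext <;> simp
    · simp
  inv_hom_id := by
    apply Span.hom_ext
    apply ChosenPullback.hom_ext
    · simp
    · apply ChosenPullback.hom_ext <;> simp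

@[simps]
def leftUnitor {X Y : E} (S : Sp X Y) : (Sp.mk (𝟙 X) (𝟙 X)).comp S ≅ S where
  hom.hom := (pb (𝟙 X) S.l).p₂
  hom.hom_l := by simpa using (pb (𝟙 X) S.l).hp₁.symm
  hom.hom_r := by simp
  inv.hom := plift S.l (𝟙 _) (by simp)
  inv.hom_l := by simp
  inv.hom_r := by simp
  hom_inv_id := by
    apply Span.hom_ext
    apply ChosenPullback.hom_ext
    · simpa using (pb (𝟙 X) S.l).hp₁.symm
    · simp
  inv_hom_id := by apply Span.hom_ext; simp

@[simps]
def rightUnitor {X Y : E} (S : Sp X Y) : S.comp (Sp.mk (𝟙 Y) (𝟙 Y)) ≅ S where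
  hom.hom := (pb S.r (𝟙 Y)).p₁
  hom.hom_l := by simp
  hom.hom_r := by simpa using (pb S.r (𝟙 Y)).hp₂.symm
  inv.hom := plift (𝟙 _) S.r (by simp)
  inv.hom_l := by simp
  inv.hom_r := by simp
  hom_inv_id := by
    apply Span.hom_ext
    apply ChosenPullback.hom_ext
    · simp
    · simpa using (pb S.r (𝟙 Y)).hp₂.symm
  inv_hom_id := by apply Span.hom_ext; simp

section Laws

variable {V W X Y Z : E}

lemma whiskerLeft_id (S : Sp X Y) (T : Sp Y Z) : whiskerLeft S (𝟙 T) = 𝟙 (S.comp T) := by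
  apply Span.hom_ext; apply ChosenPullback.hom_ext <;> simp

lemma whiskerLeft_comp (S : Sp X Y) {T T' T'' : Sp Y Z} (η : T ⟶ T') (θ : T' ⟶ T'') :
    whiskerLeft S (η ≫ θ) = whiskerLeft S η ≫ whiskerLeft S θ := by
  apply Span.hom_ext; apply ChosenPullback.hom_ext <;> simp

lemma id_whiskerLeft {S T : Sp X Y} (η : S ⟶ T) :
    whiskerLeft (Sp.mk (𝟙 X) (𝟙 X)) η = S.leftUnitor.hom ≫ η ≫ T.leftUnitor.inv := by
  apply Span.hom_ext
  apply ChosenPullback.hom_ext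
  · simpa using (pb (𝟙 X) S.l).hp₁
  · simp

lemma comp_whiskerLeft (S : Sp W X) (T : Sp X Y) {U U' : Sp Y Z} (η : U ⟶ U') :
    whiskerLeft (S.comp T) η =
      (associator S T U).hom ≫ whiskerLeft S (whiskerLeft T η) ≫ (associator S T U').inv := by
  apply Span.hom_ext
  apply ChosenPullback.hom_ext
  · apply ChosenPullback.hom_ext <;> simp
  · simp

lemma id_whiskerRight (S : Sp X Y) (T : Sp Y Z) : whiskerRight (𝟙 S) T = 𝟙 (S.comp T) := by
  apply Span.hom_ext; apply ChosenPullback.hom_ext <;> simp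

lemma comp_whiskerRight {S S' S'' : Sp X Y} (η : S ⟶ S') (θ : S' ⟶ S'') (T : Sp Y Z) :
    whiskerRight (η ≫ θ) T = whiskerRight η T ≫ whiskerRight θ T := by
  apply Span.hom_ext; apply ChosenPullback.hom_ext <;> simp

lemma whiskerRight_id {S T : Sp X Y} (η : S ⟶ T) :
    whiskerRight η (Sp.mk (𝟙 Y) (𝟙 Y)) = S.rightUnitor.hom ≫ η ≫ T.rightUnitor.inv := by
  apply Span.hom_ext
  apply ChosenPullback.hom_ext
  · simp
  · simpa using (pb S.r (𝟙 Y)).hp₂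

lemma whiskerRight_comp {S S' : Sp W X} (η : S ⟶ S') (T : Sp X Y) (U : Sp Y Z) :
    whiskerRight η (T.comp U) =
      (associator S T U).inv ≫ whiskerRight (whiskerRight η T) U ≫ (associator S' T U).hom := by
  apply Span.hom_ext
  apply ChosenPullback.hom_ext
  · simp
  · apply ChosenPullback.hom_ext <;> simp

lemma whisker_assoc (S : Sp W X) {T T' : Sp X Y} (η : T ⟶ T') (U : Sp Y Z) :
    whiskerRight (whiskerLeft S η) U =
      (associator S T U).hom ≫ whiskerLeft S (whiskerRight η U) ≫ (associator S T' U).inv := by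
  apply Span.hom_ext
  apply ChosenPullback.hom_ext
  · apply ChosenPullback.hom_ext <;> simp
  · simp

lemma whisker_exchange {S S' : Sp X Y} {T T' : Sp Y Z} (η : S ⟶ S') (θ : T ⟶ T') :
    whiskerLeft S θ ≫ whiskerRight η T' = whiskerRight η T ≫ whiskerLeft S' θ := by
  apply Span.hom_ext; apply ChosenPullback.hom_ext <;> simp

lemma pentagon (S : Sp V W) (T : Sp W X) (U : Sp X Y) (R : Sp Y Z) :
    whiskerRight (associator S T U).hom R ≫ (associator S (T.comp U) R).hom ≫
        whiskerLeft S (associator T U R).hom =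
      (associator (S.comp T) U R).hom ≫ (associator S T (U.comp R)).hom := by
  apply Span.hom_ext
  apply ChosenPullback.hom_ext
  · simp
  · apply ChosenPullback.hom_ext
    · simp
    · apply ChosenPullback.hom_ext <;> simp

lemma triangle (S : Sp X Y) (T : Sp Y Z) :
    (associator S (Sp.mk (𝟙 Y) (𝟙 Y)) T).hom ≫ whiskerLeft S T.leftUnitor.hom =
      whiskerRight S.rightUnitor.hom T := by
  apply Span.hom_ext; apply ChosenPullback.hom_ext <;> simp

end Laws

end Sp

/-- The bicategory of spans in `E`; its objects are those of `E`. -/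
structure SpanBicat (E : Type u) where
  /-- the underlying object of `E` -/
  as : E

instance SpanBicat.bicategory : Bicategory.{v, max u v} (SpanBicat E) where
  Hom X Y := Sp X.as Y.as
  id X := Sp.mk (𝟙 X.as) (𝟙 X.as)
  comp S T := Sp.comp S T
  homCategory X Y := inferInstanceAs (Category (Sp X.as Y.as))
  whiskerLeft S _ _ η := Sp.whiskerLeft S η
  whiskerRight η T := Sp.whiskerRight η T
  associator S T U := Sp.associator S T U
  leftUnitor S := Sp.leftUnitor S
  rightUnitor S := Sp.rightUnitor S
  whiskerLeft_id S T := Sp.whiskerLeft_id S T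
  whiskerLeft_comp S _ _ _ η θ := Sp.whiskerLeft_comp S η θ
  id_whiskerLeft η := Sp.id_whiskerLeft η
  comp_whiskerLeft S T _ _ η := Sp.comp_whiskerLeft S T η
  id_whiskerRight S T := Sp.id_whiskerRight S T
  comp_whiskerRight η θ T := Sp.comp_whiskerRight η θ T
  whiskerRight_id η := Sp.whiskerRight_id η
  whiskerRight_comp η T U := Sp.whiskerRight_comp η T U
  whisker_assoc S _ _ η U := Sp.whisker_assoc S η U
  whisker_exchange η θ := Sp.whisker_exchange η θ
  pentagon S T U R := Sp.pentagon S T U R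
  triangle S T := Sp.triangle S T

/-- The 2-cells of the embedding `(-)_Σ`: the identity of the apex. -/
@[simps]
def sigmaHom {X Y : E} {f g : X ⟶ Y} (h : f = g) : Sp.mk (𝟙 X) f ⟶ Sp.mk (𝟙 X) g where
  hom := 𝟙 X
  hom_r := by simp [h]

/-- The comparison of `(X = X ⟶ Z)` with the composite of `(X = X ⟶ Y)` and `(Y = Y ⟶ Z)`. -/
@[simps]
def sigmaComp {X Y Z : E} (f : X ⟶ Y) (g : Y ⟶ Z) :
    Sp.mk (𝟙 X) (f ≫ g) ≅ (Sp.mk (𝟙 X) f).comp (Sp.mk (𝟙 Y) g) where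
  hom.hom := plift (𝟙 X) f (by simp)
  hom.hom_l := by simp
  hom.hom_r := by simp
  inv.hom := (pb f (𝟙 Y)).p₁
  inv.hom_l := by simp
  inv.hom_r := by simpa using (pb f (𝟙 Y)).condition_assoc g
  hom_inv_id := by apply Span.hom_ext; simp
  inv_hom_id := by
    apply Span.hom_ext
    apply ChosenPullback.hom_ext
    · simp
    · simpa using (pb f (𝟙 Y)).hp₂.symm

section SigmaLaws

variable {W X Y Z : E}

lemma sigma_whiskerLeft (f : X ⟶ Y) {g g' : Y ⟶ Z} (h : g = g') (h' : f ≫ g = f ≫ g') :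
    sigmaHom h' = (sigmaComp f g).hom ≫ Sp.whiskerLeft (Sp.mk (𝟙 X) f) (sigmaHom h) ≫
      (sigmaComp f g').inv := by
  apply Span.hom_ext; simp

lemma sigma_whiskerRight {f f' : X ⟶ Y} (h : f = f') (g : Y ⟶ Z) (h' : f ≫ g = f' ≫ g) :
    sigmaHom h' = (sigmaComp f g).hom ≫ Sp.whiskerRight (sigmaHom h) (Sp.mk (𝟙 Y) g) ≫
      (sigmaComp f' g).inv := by
  apply Span.hom_ext; simp

lemma sigma_associator (f : W ⟶ X) (g : X ⟶ Y) (h : Y ⟶ Z) (e : (f ≫ g) ≫ h = f ≫ g ≫ h) :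
    sigmaHom e = (sigmaComp (f ≫ g) h).hom ≫
      Sp.whiskerRight (sigmaComp f g).hom (Sp.mk (𝟙 Y) h) ≫
      (Sp.associator (Sp.mk (𝟙 W) f) (Sp.mk (𝟙 X) g) (Sp.mk (𝟙 Y) h)).hom ≫
      Sp.whiskerLeft (Sp.mk (𝟙 W) f) (sigmaComp g h).inv ≫ (sigmaComp f (g ≫ h)).inv := by
  apply Span.hom_ext; simp

lemma sigma_leftUnitor (f : X ⟶ Y) (e : 𝟙 X ≫ f = f) :
    sigmaHom e = (sigmaComp (𝟙 X) f).hom ≫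
      Sp.whiskerRight (𝟙 (Sp.mk (𝟙 X) (𝟙 X))) (Sp.mk (𝟙 X) f) ≫
      (Sp.leftUnitor (Sp.mk (𝟙 X) f)).hom := by
  apply Span.hom_ext; simp

lemma sigma_rightUnitor (f : X ⟶ Y) (e : f ≫ 𝟙 Y = f) :
    sigmaHom e = (sigmaComp f (𝟙 Y)).hom ≫
      Sp.whiskerLeft (Sp.mk (𝟙 X) f) (𝟙 (Sp.mk (𝟙 Y) (𝟙 Y))) ≫
      (Sp.rightUnitor (Sp.mk (𝟙 X) f)).hom := by
  apply Span.hom_ext; simp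

end SigmaLaws

variable (E) in
/-- The embedding `(-)_Σ : E → Span(E)`, the identity on objects, sending `f : X ⟶ Y` to the span
`X ⟵ X ⟶ Y` with legs `𝟙 X` and `f`. -/
def sigma : LocallyDiscrete E ⥤ᵖ SpanBicat E where
  obj X := ⟨X.as⟩
  map {X _} f := Sp.mk (𝟙 X.as) f.as
  map₂ η := sigmaHom (congrArg Discrete.as (LocallyDiscrete.eq_of_hom η))
  map₂_id _ := rfl
  map₂_comp {_ _ f g h} _ _ := by
    apply Span.hom_ext
    exact (Category.comp_id _).symm
  mapId X := Iso.refl (Sp.mk (𝟙 X.as) (𝟙 X.as))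
  mapComp f g := sigmaComp f.as g.as
  map₂_whisker_left _ _ _ _ := sigma_whiskerLeft _ _ _
  map₂_whisker_right _ _ := sigma_whiskerRight _ _ _
  map₂_associator _ _ _ := sigma_associator _ _ _ _
  map₂_left_unitor _ := sigma_leftUnitor _ _
  map₂_right_unitor _ := sigma_rightUnitor _ _

end Span

/-! ### Icons -/

section Icons

variable {A : Type u₁} [Bicategory.{w₁, v₁} A] {B : Type u₂} [Bicategory.{w₂, v₂} B]
  {C : Type u₃} [Bicategory.{w₃, v₃} C]

/-- The identification of the hom-categories `C(x', y')` and `C(x, y)` for `x = x'`, `y = y'`. -/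
def castHom {x x' y y' : C} (hx : x = x') (hy : y = y') : (x' ⟶ y') ⥤ (x ⟶ y) := by
  subst hx hy
  exact 𝟭 _

/-- The identifications of hom-categories respect composition of 1-cells (an identity). -/
def castHomComp {x x' y y' z z' : C} (hx : x = x') (hy : y = y') (hz : z = z')
    (f : x' ⟶ y') (g : y' ⟶ z') :
    (castHom hx hy).obj f ≫ (castHom hy hz).obj g ≅ (castHom hx hz).obj (f ≫ g) :=
  eqToIso (by subst hx hy hz; rfl)

/-- The identifications of hom-categories respect identity 1-cells (an identity). -/
def castHomId {x x' : C} (hx : x = x') : (castHom hx hx).obj (𝟙 x') ≅ 𝟙 x :=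
  eqToIso (by subst hx; rfl)

/-- An icon `F ⇒ G` between oplax functors: `F` and `G` agree on objects, and there are natural
transformations `F_{a,b} ⇒ G_{a,b}` between the local functors that are compatible with the
oplax constraints. The identification of `G_{a,b}` with a functor into `C(F a, F b)`
is made explicit. -/
@[ext]
structure Icon (F G : B ⥤ᵒᵖᴸ C) where
  obj_eq (a : B) : F.obj a = G.obj a
  app (a b : B) : F.mapFunctor a b ⟶ G.mapFunctor a b ⋙ castHom (obj_eq a) (obj_eq b)
  app_comp {a b c : B} (f : a ⟶ b) (g : b ⟶ c) :
    (app a c).app (f ≫ g) ≫ (castHom (obj_eq a) (obj_eq c)).map (G.mapComp f g) =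
      F.mapComp f g ≫ (app a b).app f ▷ F.map g ≫
        (castHom (obj_eq a) (obj_eq b)).obj (G.map f) ◁ (app b c).app g ≫
        (castHomComp (obj_eq a) (obj_eq b) (obj_eq c) (G.map f) (G.map g)).hom
  app_id (a : B) :
    (app a a).app (𝟙 a) ≫ (castHom (obj_eq a) (obj_eq a)).map (G.mapId a) ≫
      (castHomId (obj_eq a)).hom = F.mapId a

namespace Icon

/-- Successive identifications of hom-categories compose. -/
def castHomTrans {x x' x'' y y' y'' : C} (hx : x = x') (hx' : x' = x'') (hy : y = y')
    (hy' : y' = y'') :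
    castHom hx' hy' ⋙ castHom hx hy ≅ castHom (hx.trans hx') (hy.trans hy') :=
  eqToIso (by subst hx hx' hy hy'; rfl)

/-- The identity icon. -/
def id (F : B ⥤ᵒᵖᴸ C) : Icon F F where
  obj_eq _ := rfl
  app a b := (Functor.rightUnitor (F.mapFunctor a b)).inv
  app_comp {a b c} f g := by
    change 𝟙 (F.map (f ≫ g)) ≫ F.mapComp f g =
      F.mapComp f g ≫ 𝟙 (F.map f) ▷ F.map g ≫ F.map f ◁ 𝟙 (F.map g) ≫ 𝟙 (F.map f ≫ F.map g)
    simp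
  app_id a := by
    change 𝟙 (F.map (𝟙 a)) ≫ F.mapId a ≫ 𝟙 (𝟙 (F.obj a)) = F.mapId a
    simp

lemma comp_aux {x x' x'' y y' y'' z z' z'' : C} (hx : x = x') (hx' : x' = x'')
    (hy : y = y') (hy' : y' = y'') (hz : z = z') (hz' : z' = z'')
    {f₁ : x ⟶ y} {f₂ : y ⟶ z} {f : x ⟶ z} (φ : f ⟶ f₁ ≫ f₂)
    {g₁ : x' ⟶ y'} {g₂ : y' ⟶ z'} {g : x' ⟶ z'} (ψ : g ⟶ g₁ ≫ g₂)
    {h₁ : x'' ⟶ y''} {h₂ : y'' ⟶ z''} {h : x'' ⟶ z''} (χ : h ⟶ h₁ ≫ h₂)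
    (α₁ : f₁ ⟶ (castHom hx hy).obj g₁) (α₂ : f₂ ⟶ (castHom hy hz).obj g₂)
    (α : f ⟶ (castHom hx hz).obj g)
    (β₁ : g₁ ⟶ (castHom hx' hy').obj h₁) (β₂ : g₂ ⟶ (castHom hy' hz').obj h₂)
    (β : g ⟶ (castHom hx' hz').obj h)
    (hα : α ≫ (castHom hx hz).map ψ = φ ≫ α₁ ▷ f₂ ≫ (castHom hx hy).obj g₁ ◁ α₂ ≫
      (castHomComp hx hy hz g₁ g₂).hom)
    (hβ : β ≫ (castHom hx' hz').map χ = ψ ≫ β₁ ▷ g₂ ≫ (castHom hx' hy').obj h₁ ◁ β₂ ≫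
      (castHomComp hx' hy' hz' h₁ h₂).hom) :
    (α ≫ (castHom hx hz).map β ≫ (castHomTrans hx hx' hz hz').hom.app h) ≫
        (castHom (hx.trans hx') (hz.trans hz')).map χ =
      φ ≫ (α₁ ≫ (castHom hx hy).map β₁ ≫ (castHomTrans hx hx' hy hy').hom.app h₁) ▷ f₂ ≫
        (castHom (hx.trans hx') (hy.trans hy')).obj h₁ ◁
          (α₂ ≫ (castHom hy hz).map β₂ ≫ (castHomTrans hy hy' hz hz').hom.app h₂) ≫
        (castHomComp (hx.trans hx') (hy.trans hy') (hz.trans hz') h₁ h₂).hom := by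
  subst hx hx' hy hy' hz hz'
  change f₁ ⟶ g₁ at α₁
  change f₂ ⟶ g₂ at α₂
  change f ⟶ g at α
  change g₁ ⟶ h₁ at β₁
  change g₂ ⟶ h₂ at β₂
  change g ⟶ h at β
  change α ≫ ψ = φ ≫ α₁ ▷ f₂ ≫ g₁ ◁ α₂ ≫ 𝟙 (g₁ ≫ g₂) at hα
  change β ≫ χ = ψ ≫ β₁ ▷ g₂ ≫ h₁ ◁ β₂ ≫ 𝟙 (h₁ ≫ h₂) at hβ
  change (α ≫ β ≫ 𝟙 h) ≫ χ = φ ≫ (α₁ ≫ β₁ ≫ 𝟙 h₁) ▷ f₂ ≫ h₁ ◁ (α₂ ≫ β₂ ≫ 𝟙 h₂) ≫ 𝟙 (h₁ ≫ h₂)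
  simp only [Category.comp_id, Category.assoc, comp_whiskerRight, whiskerLeft_comp] at hα hβ ⊢
  rw [hβ, reassoc_of% hα, whisker_exchange_assoc]

lemma id_aux {x x' x'' : C} (hx : x = x') (hx' : x' = x'')
    {f : x ⟶ x} (φ : f ⟶ 𝟙 x) {g : x' ⟶ x'} (ψ : g ⟶ 𝟙 x') {h : x'' ⟶ x''} (χ : h ⟶ 𝟙 x'')
    (α : f ⟶ (castHom hx hx).obj g) (β : g ⟶ (castHom hx' hx').obj h)
    (hα : α ≫ (castHom hx hx).map ψ ≫ (castHomId hx).hom = φ)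
    (hβ : β ≫ (castHom hx' hx').map χ ≫ (castHomId hx').hom = ψ) :
    (α ≫ (castHom hx hx).map β ≫ (castHomTrans hx hx' hx hx').hom.app h) ≫
      (castHom (hx.trans hx') (hx.trans hx')).map χ ≫ (castHomId (hx.trans hx')).hom = φ := by
  subst hx hx'
  change f ⟶ g at α
  change g ⟶ h at β
  change α ≫ ψ ≫ 𝟙 _ = φ at hα
  change β ≫ χ ≫ 𝟙 _ = ψ at hβ
  change (α ≫ β ≫ 𝟙 h) ≫ χ ≫ 𝟙 _ = φ
  simp only [Category.comp_id, Category.assoc] at hα hβ ⊢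
  rw [hβ, hα]

/-- Vertical composition of icons. -/
def comp {F G H : B ⥤ᵒᵖᴸ C} (α : Icon F G) (β : Icon G H) : Icon F H where
  obj_eq a := (α.obj_eq a).trans (β.obj_eq a)
  app a b := α.app a b ≫ Functor.whiskerRight (β.app a b) (castHom (α.obj_eq a) (α.obj_eq b)) ≫
    Functor.whiskerLeft (H.mapFunctor a b)
      (castHomTrans (α.obj_eq a) (β.obj_eq a) (α.obj_eq b) (β.obj_eq b)).hom
  app_comp f g := comp_aux _ _ _ _ _ _ _ _ _ _ _ _ _ _ _ (α.app_comp f g) (β.app_comp f g)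
  app_id a := id_aux _ _ _ _ _ _ _ (α.app_id a) (β.app_id a)

lemma assoc_aux {x x₁ x₂ x₃ y y₁ y₂ y₃ : C} (hx : x = x₁) (hx₁ : x₁ = x₂)
    (hx₂ : x₂ = x₃) (hy : y = y₁) (hy₁ : y₁ = y₂) (hy₂ : y₂ = y₃)
    {f : x ⟶ y} {g : x₁ ⟶ y₁} {h : x₂ ⟶ y₂} {k : x₃ ⟶ y₃}
    (α : f ⟶ (castHom hx hy).obj g) (β : g ⟶ (castHom hx₁ hy₁).obj h)
    (γ : h ⟶ (castHom hx₂ hy₂).obj k) :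
    (α ≫ (castHom hx hy).map β ≫ (castHomTrans hx hx₁ hy hy₁).hom.app h) ≫
        (castHom (hx.trans hx₁) (hy.trans hy₁)).map γ ≫
        (castHomTrans (hx.trans hx₁) hx₂ (hy.trans hy₁) hy₂).hom.app k =
      α ≫ (castHom hx hy).map
          (β ≫ (castHom hx₁ hy₁).map γ ≫ (castHomTrans hx₁ hx₂ hy₁ hy₂).hom.app k) ≫
        (castHomTrans hx (hx₁.trans hx₂) hy (hy₁.trans hy₂)).hom.app k := by
  subst hx hx₁ hx₂ hy hy₁ hy₂
  change f ⟶ g at α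
  change g ⟶ h at β
  change h ⟶ k at γ
  change (α ≫ β ≫ 𝟙 h) ≫ γ ≫ 𝟙 k = α ≫ (β ≫ γ ≫ 𝟙 k) ≫ 𝟙 k
  simp

lemma id_comp_aux {x x' y y' : C} (hx : x = x') (hy : y = y') {f : x ⟶ y} {g : x' ⟶ y'}
    (α : f ⟶ (castHom hx hy).obj g) :
    𝟙 f ≫ (castHom (rfl : x = x) (rfl : y = y)).map α ≫ (castHomTrans rfl hx rfl hy).hom.app g =
      α := by
  subst hx hy
  change f ⟶ g at α
  change 𝟙 f ≫ α ≫ 𝟙 g = α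
  simp

lemma comp_id_aux {x x' y y' : C} (hx : x = x') (hy : y = y') {f : x ⟶ y} {g : x' ⟶ y'}
    (α : f ⟶ (castHom hx hy).obj g) :
    α ≫ (castHom hx hy).map (𝟙 g) ≫ (castHomTrans hx rfl hy rfl).hom.app g = α := by
  subst hx hy
  change f ⟶ g at α
  change α ≫ 𝟙 g ≫ 𝟙 g = α
  simp

lemma ext_app {F G : B ⥤ᵒᵖᴸ C} {α β : Icon F G}
    (h : ∀ (a b : B) (f : a ⟶ b), (α.app a b).app f = (β.app a b).app f) : α = β := by
  apply Icon.ext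
  funext a b
  apply NatTrans.ext
  funext f
  exact h a b f

end Icon

variable (B C) in
/-- The category of oplax functors `B → C` and icons. -/
structure OplaxIcon where
  /-- the underlying oplax functor -/
  fn : B ⥤ᵒᵖᴸ C

instance : Category (OplaxIcon B C) where
  Hom F G := Icon F.fn G.fn
  id F := Icon.id F.fn
  comp α β := Icon.comp α β
  id_comp _ := Icon.ext_app fun _ _ _ => Icon.id_comp_aux _ _ _
  comp_id _ := Icon.ext_app fun _ _ _ => Icon.comp_id_aux _ _ _
  assoc _ _ _ := Icon.ext_app fun _ _ _ => Icon.assoc_aux _ _ _ _ _ _ _ _ _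

lemma Icon.precomp_aux {x x' y y' z z' : C} (hx : x = x') (hy : y = y') (hz : z = z')
    {f₁ : x ⟶ y} {f₂ : y ⟶ z} {f f' : x ⟶ z} (θ : f' ⟶ f) (φ : f ⟶ f₁ ≫ f₂)
    {g₁ : x' ⟶ y'} {g₂ : y' ⟶ z'} {g g' : x' ⟶ z'} (θ' : g' ⟶ g) (ψ : g ⟶ g₁ ≫ g₂)
    (α₁ : f₁ ⟶ (castHom hx hy).obj g₁) (α₂ : f₂ ⟶ (castHom hy hz).obj g₂)
    (α : f ⟶ (castHom hx hz).obj g) (α' : f' ⟶ (castHom hx hz).obj g')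
    (hα : α ≫ (castHom hx hz).map ψ = φ ≫ α₁ ▷ f₂ ≫ (castHom hx hy).obj g₁ ◁ α₂ ≫
      (castHomComp hx hy hz g₁ g₂).hom)
    (hα' : θ ≫ α = α' ≫ (castHom hx hz).map θ') :
    α' ≫ (castHom hx hz).map (θ' ≫ ψ) = (θ ≫ φ) ≫ α₁ ▷ f₂ ≫ (castHom hx hy).obj g₁ ◁ α₂ ≫
      (castHomComp hx hy hz g₁ g₂).hom := by
  rw [Functor.map_comp, ← reassoc_of% hα', hα]
  simp

lemma Icon.precomp_id_aux {x x' : C} (hx : x = x')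
    {f f' : x ⟶ x} (θ : f' ⟶ f) (φ : f ⟶ 𝟙 x) {g g' : x' ⟶ x'} (θ' : g' ⟶ g) (ψ : g ⟶ 𝟙 x')
    (α : f ⟶ (castHom hx hx).obj g) (α' : f' ⟶ (castHom hx hx).obj g')
    (hα : α ≫ (castHom hx hx).map ψ ≫ (castHomId hx).hom = φ)
    (hα' : θ ≫ α = α' ≫ (castHom hx hx).map θ') :
    α' ≫ (castHom hx hx).map (θ' ≫ ψ) ≫ (castHomId hx).hom = θ ≫ φ := by
  rw [Functor.map_comp, Category.assoc, ← reassoc_of% hα', hα]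

/-- Composition with an oplax functor `P : A → B`, as a functor from oplax functors `B → C` and
icons to oplax functors `A → C` and icons. -/
def iconPrecomp (P : A ⥤ᵒᵖᴸ B) : OplaxIcon B C ⥤ OplaxIcon A C where
  obj F := ⟨P.comp F.fn⟩
  map α :=
    { obj_eq := fun a => Icon.obj_eq α (P.obj a)
      app := fun a b => Functor.whiskerLeft (P.mapFunctor a b) (Icon.app α (P.obj a) (P.obj b))
      app_comp := fun f g => Icon.precomp_aux _ _ _ _ _ _ _ _ _ _ _
        (Icon.app_comp α (P.map f) (P.map g)) ((Icon.app α _ _).naturality (P.mapComp f g))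
      app_id := fun a => Icon.precomp_id_aux _ _ _ _ _ _ _
        (Icon.app_id α (P.obj a)) ((Icon.app α _ _).naturality (P.mapId a)) }
  map_id _ := rfl
  map_comp _ _ := rfl

/-! ### Gregarious functors and pseudofunctors -/

variable (B C) in
/-- A normal oplax functor is gregarious if the constraint `F (f ≫ g) ⟶ F f ≫ F g` is invertible
whenever `g` has a right adjoint. Normal means that the unit constraints are invertible. -/
def IsGregarious : ObjectProperty (OplaxIcon B C) := fun F =>
  (∀ a : B, IsIso (F.fn.mapId a)) ∧
    ∀ {a b c : B} (f : a ⟶ b) (g : b ⟶ c), IsLeftAdjoint g → IsIso (F.fn.mapComp f g)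

variable (B C) in
/-- `Greg(B, C)`: gregarious functors and icons. -/
abbrev Greg := (IsGregarious B C).FullSubcategory

variable (B C) in
/-- `Icon(B, C)`: pseudofunctors and icons. -/
abbrev PsIcon := InducedCategory (OplaxIcon B C) (fun F : B ⥤ᵖ C => OplaxIcon.mk F.toOplax)

variable (B C) in
/-- The inclusion of pseudofunctors into gregarious functors. -/
def psToGreg : PsIcon B C ⥤ Greg B C :=
  (IsGregarious B C).lift (inducedFunctor _) fun F =>
    ⟨fun a => (F.mapId a).isIso_hom, fun f g _ => (F.mapComp f g).isIso_hom⟩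

end Icons

/-! ### Sinister pseudofunctors and the Beck condition -/

section Sinister

variable (E : Type u) [Category.{v} E] (C : Type u₁) [Bicategory.{w₁, v₁} C]

/-- A pseudofunctor from a category is sinister if it sends every morphism to a 1-cell that has a
right adjoint. -/
def IsSinister : ObjectProperty (PsIcon (LocallyDiscrete E) C) :=
  fun F : LocallyDiscrete E ⥤ᵖ C => ∀ {X Y : E} (f : X ⟶ Y), IsLeftAdjoint (F.map f.toLoc)

/-- `Sin(E, C)`: sinister pseudofunctors and invertible icons. -/
abbrev Sin := Core (IsSinister E C).FullSubcategory

/-- The forgetful functor from `Sin(E, C)` to oplax functors and icons. -/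
def sinForget : Sin E C ⥤ OplaxIcon (LocallyDiscrete E) C :=
  Core.inclusion _ ⋙ (IsSinister E C).ι ⋙ inducedFunctor _

variable {E C} in
/-- The Beck 2-cell of a commutative square `f' ≫ g = g' ≫ f`, for right adjoints `r'` of `F g'`
and `r` of `F g`: the mate `r' ≫ F f' ⟶ F f ≫ r` of the invertible 2-cell
`F f' ≫ F g ⟶ F g' ≫ F f`. -/
def beckCell (F : LocallyDiscrete E ⥤ᵖ C) {P X Y Z : E} {f' : P ⟶ X} {g' : P ⟶ Y} {g : X ⟶ Z}
    {f : Y ⟶ Z} (sq : CommSq f' g' g f) {r' : F.obj ⟨Y⟩ ⟶ F.obj ⟨P⟩} {r : F.obj ⟨Z⟩ ⟶ F.obj ⟨X⟩}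
    (adj' : F.map g'.toLoc ⊣ r') (adj : F.map g.toLoc ⊣ r) :
    r' ≫ F.map f'.toLoc ⟶ F.map f.toLoc ≫ r :=
  mateEquiv adj' adj (F.isoMapOfCommSq sq.toLoc).hom

variable {E C} in
/-- The Beck condition: the Beck 2-cell of every pullback square is invertible. (Whether it is
does not depend on the choice of the right adjoints.) -/
def BeckCondition (F : LocallyDiscrete E ⥤ᵖ C) : Prop :=
  ∀ {P X Y Z : E} {f' : P ⟶ X} {g' : P ⟶ Y} {g : X ⟶ Z} {f : Y ⟶ Z} (sq : IsPullback f' g' g f)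
    {r' : F.obj ⟨Y⟩ ⟶ F.obj ⟨P⟩} {r : F.obj ⟨Z⟩ ⟶ F.obj ⟨X⟩}
    (adj' : F.map g'.toLoc ⊣ r') (adj : F.map g.toLoc ⊣ r),
    IsIso (beckCell F sq.toCommSq adj' adj)

/-- The property of satisfying the Beck condition, for objects of `Sin(E, C)`. -/
def IsBeck : ObjectProperty (Sin E C) := fun F => BeckCondition F.of.obj

/-- `Beck(E, C)`: the full subcategory of `Sin(E, C)` on those sinister pseudofunctors which
satisfy the Beck condition. -/
abbrev Beck := (IsBeck E C).FullSubcategory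

end Sinister

end SpanUP

open SpanUP

/-! A span `S` with legs `s` and `t` is, up to isomorphism, the right adjoint of `s_Σ` followed by
`t_Σ`. Equivalently, an evident 2-cell `t_Σ ⟶ s_Σ ≫ S` exhibits `S` as a left extension of `t_Σ`
along `s_Σ`. A gregarious functor preserves these extensions: it preserves the adjunction of `s_Σ`,
because the only constraint to be inverted there ends in the left adjoint `s_Σ`, and it preserves
the composite with `t_Σ`, which is again a left adjoint (`isUniv_oplaxCell`). So its values on
spans, on their 2-cells and on the constraints are forced by its restriction to the morphisms of the
base category.

`Extension` axiomatizes this situation: universal cells, together with their restrictions along all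
morphisms `a` into the apex, in the style of generalized elements. Both a gregarious functor
(`gregExtension`) and the formula `(F s)^* ≫ F t` for a sinister `F` (`Extension.ofSinister`) give
extensions. A 2-cell out of `map S` is tested on one universal cell, so the oplax coherence laws
reduce to computations with pullback projections.

Full faithfulness: an icon between gregarious functors is automatically invertible at each `f_Σ`, by
the usual mate argument (`Icon.isIso_cmp_of_adj`), and its component at a span is then determined by
those at the legs (`oplaxCell_cmp`). Conversely, an invertible icon on the base induces comparisons
of the extensions (`Extension.icon`). Essential surjectivity: the extension of a sinister functor is
gregarious because a span with a right adjoint has invertible left leg (`isIso_l_of_isLeftAdjoint`),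
and its restriction is the given functor (`Extension.sigmaIcon`).

For the second equivalence, the composition constraint at `S` and `T` compares the universal cell of
the composite with a pasting of restricted cells. That pasting is universal as soon as the Beck cell
of the pullback is (`Base.isUniv_paste_restr`). Conversely, an invertible constraint at a span `f_Σ`
followed by a reversed span yields the Beck cell (`Extension.isUniv_beck`). -/

namespace SpanUP

/-! ### Universal cells -/

section Universal

variable {C : Type u₁} [Bicategory.{w₁, v₁} C] {a b c d : C}

/-- A 2-cell `q : k ⟶ l ≫ m` is universal if it exhibits `m` as a left extension of `k`
along `l`. -/
def IsUniv {l : a ⟶ b} {k : a ⟶ c} {m : b ⟶ c} (q : k ⟶ l ≫ m) : Prop :=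
  ∀ m' : b ⟶ c, Function.Bijective (fun θ : m ⟶ m' => q ≫ l ◁ θ)

namespace IsUniv

variable {l l' : a ⟶ b} {k k' : a ⟶ c} {m m' : b ⟶ c} {q : k ⟶ l ≫ m}

lemma hom_ext (h : IsUniv q) {θ θ' : m ⟶ m'} (e : q ≫ l ◁ θ = q ≫ l ◁ θ') : θ = θ' :=
  (h _).1 e

/-- The 2-cell out of the extension given by its universal property. -/
noncomputable def desc (h : IsUniv q) (p : k ⟶ l ≫ m') : m ⟶ m' := ((h m').2 p).choose

@[simp]
lemma fac (h : IsUniv q) (p : k ⟶ l ≫ m') : q ≫ l ◁ h.desc p = p := ((h m').2 p).choose_spec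

@[simp]
lemma fac_assoc (h : IsUniv q) (p : k ⟶ l ≫ m') {n : a ⟶ c} (φ : l ≫ m' ⟶ n) :
    q ≫ l ◁ h.desc p ≫ φ = p ≫ φ := by
  rw [← Category.assoc, fac]

lemma isIso (h : IsUniv q) {q' : k ⟶ l ≫ m'} (h' : IsUniv q') (θ : m ⟶ m')
    (e : q ≫ l ◁ θ = q') : IsIso θ := by
  refine ⟨h'.desc q, h.hom_ext ?_, h'.hom_ext ?_⟩
  · simp [reassoc_of% e]
  · simp [e]

lemma comp_isIso (h : IsUniv q) (θ : m ⟶ m') [IsIso θ] : IsUniv (q ≫ l ◁ θ) := by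
  intro n
  have := (h n).comp ((asIso θ).homFromEquiv (Z := n)).symm.bijective
  convert this using 1
  funext φ
  simp

lemma of_comp_isIso (θ : m ⟶ m') [IsIso θ] (h : IsUniv (q ≫ l ◁ θ)) : IsUniv q := by
  simpa using h.comp_isIso (inv θ)

lemma isIso_comp (h : IsUniv q) (φ : k' ⟶ k) [IsIso φ] : IsUniv (φ ≫ q) := by
  intro n
  have := ((asIso φ).homFromEquiv (Z := l ≫ n)).symm.bijective.comp (h n)
  convert this using 1
  funext φ
  simp

lemma comp_isIso_whiskerRight (h : IsUniv q) (ψ : l ⟶ l') [IsIso ψ] : IsUniv (q ≫ ψ ▷ m) := by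
  intro n
  have := ((asIso (ψ ▷ n)).homToEquiv (Z := k)).bijective.comp (h n)
  convert this using 1
  funext φ
  simp [whisker_exchange]

/-- Universal cells compose. -/
lemma trans (h : IsUniv q) {d : C} {l₂ : b ⟶ d} {m₂ : d ⟶ c} {q₂ : m ⟶ l₂ ≫ m₂}
    (h₂ : IsUniv q₂) : IsUniv (q ≫ l ◁ q₂ ≫ (α_ l l₂ m₂).inv) := by
  intro n
  have := ((α_ l l₂ n).symm.homToEquiv (Z := k)).bijective.comp ((h _).comp (h₂ n))
  convert this using 1
  funext φ
  simp

end IsUniv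

/-! ### Universal cells along left adjoints and equivalences -/

section Adjunction

variable {l : a ⟶ b} {r : b ⟶ a} (adj : l ⊣ r) {k : a ⟶ c} {m m' : b ⟶ c}

lemma homEquiv₁_comp (q : k ⟶ l ≫ m) (θ : m ⟶ m') :
    adj.homEquiv₁ (q ≫ l ◁ θ) = adj.homEquiv₁ q ≫ θ := by
  rw [Adjunction.homEquiv₁_apply, Adjunction.homEquiv₁_apply, whiskerLeft_comp, Category.assoc,
    associator_inv_naturality_right_assoc, whisker_exchange_assoc, id_whiskerLeft]
  simp

/-- Transposition turns pasting with `θ` into composition with `θ`, so universality says that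
composing with the transpose is bijective, and Yoneda applies. -/
lemma isUniv_iff (q : k ⟶ l ≫ m) : IsUniv q ↔ IsIso (adj.homEquiv₁ q) := by
  rw [isIso_iff_coyoneda_map_bijective]
  refine forall_congr' fun n => ?_
  rw [← Function.Bijective.of_comp_iff' (adj.homEquiv₁ (g := k) (h := n)).bijective]
  refine iff_of_eq (congrArg _ (funext fun θ => ?_))
  exact homEquiv₁_comp adj q θ

lemma isUniv_homEquiv₁_symm (θ : r ≫ k ⟶ m) [IsIso θ] : IsUniv (adj.homEquiv₁.symm θ) := by
  rw [isUniv_iff adj]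
  simpa

lemma isUniv_unit : IsUniv adj.unit := by
  rw [isUniv_iff adj]
  have : adj.homEquiv₁ adj.unit = (ρ_ r).hom := by
    rw [← Equiv.eq_symm_apply, Adjunction.homEquiv₁_symm_apply]
    simp
  rw [this]
  infer_instance

/-- A universal cell along a left adjoint is absolute. -/
lemma IsUniv.whiskerRight [hl : IsLeftAdjoint l] {q : k ⟶ l ≫ m} (h : IsUniv q) (n : c ⟶ d) :
    IsUniv (q ▷ n ≫ (α_ l m n).hom) := by
  have adj := Adjunction.ofIsLeftAdjoint l
  have := (isUniv_iff adj q).1 h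
  rw [isUniv_iff adj]
  -- Transposition commutes with whiskering on the far side, and whiskering preserves isomorphisms.
  have e : adj.homEquiv₁ (q ▷ n ≫ (α_ l m n).hom) =
      (α_ _ _ _).inv ≫ adj.homEquiv₁ q ▷ n := by
    simp only [Adjunction.homEquiv₁_apply]
    bicategory
  rw [e]
  infer_instance

end Adjunction

/-- The adjunction underlying an adjoint equivalence. -/
def adjunctionOfEquivalence (e : a ≌ b) : e.hom ⊣ e.inv where
  unit := e.unit.hom
  counit := e.counit.hom
  left_triangle := e.left_triangle_hom
  right_triangle := e.right_triangle_hom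

/-- A cell along an equivalence is universal if and only if it is invertible. -/
lemma isUniv_iff_isIso (e : a ≌ b) {k : a ⟶ c} {m : b ⟶ c} (q : k ⟶ e.hom ≫ m) :
    IsUniv q ↔ IsIso q := by
  rw [isUniv_iff (adjunctionOfEquivalence e)]
  -- Unit and counit of an equivalence are invertible, so transposition preserves and reflects
  -- invertibility.
  constructor
  · intro h
    rw [← (adjunctionOfEquivalence e).homEquiv₁.symm_apply_apply q,
      Adjunction.homEquiv₁_symm_apply]
    dsimp [adjunctionOfEquivalence] at h ⊢
    infer_instance
  · intro h
    rw [Adjunction.homEquiv₁_apply]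
    dsimp [adjunctionOfEquivalence]
    infer_instance

end Universal

end SpanUP

namespace SpanUP

/-! ### Cells over an object -/

section Paste

variable {C : Type u₁} [Bicategory.{w₁, v₁} C] {a b c d e : C}

/-- The pasting of `y ⟶ x ≫ m` and `z ⟶ y ≫ n`. -/
def paste {x : a ⟶ b} {y : a ⟶ c} {z : a ⟶ d} {m : b ⟶ c} {n : c ⟶ d} (q : y ⟶ x ≫ m)
    (q' : z ⟶ y ≫ n) : z ⟶ x ≫ m ≫ n :=
  q' ≫ q ▷ n ≫ (α_ x m n).hom

variable {x : a ⟶ b} {y : a ⟶ c} {z : a ⟶ d} {w : a ⟶ e} {m m' : b ⟶ c} {n n' : c ⟶ d} {p : d ⟶ e}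

lemma paste_assoc (q : y ⟶ x ≫ m) (q' : z ⟶ y ≫ n) (q'' : w ⟶ z ≫ p) :
    paste (paste q q') q'' ≫ x ◁ (α_ m n p).hom = paste q (paste q' q'') := by
  simp [paste]

lemma paste_comp_left (q : y ⟶ x ≫ m) (q' : z ⟶ y ≫ n) (θ : m ⟶ m') :
    paste (q ≫ x ◁ θ) q' = paste q q' ≫ x ◁ θ ▷ n := by
  simp [paste]

lemma paste_comp_right (q : y ⟶ x ≫ m) (q' : z ⟶ y ≫ n) (θ : n ⟶ n') :
    paste q (q' ≫ y ◁ θ) = paste q q' ≫ x ◁ m ◁ θ := by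
  simp [paste, whisker_exchange_assoc]

lemma paste_unit_left (q' : z ⟶ y ≫ n) : paste (ρ_ y).inv q' ≫ y ◁ (λ_ n).hom = q' := by
  simp [paste]

lemma paste_unit_right (q : y ⟶ x ≫ m) : paste q (ρ_ y).inv ≫ x ◁ (ρ_ m).hom = q := by
  simp only [paste]
  bicategory

end Paste

/-- A pseudofunctor from a category to a bicategory with a prescribed object function `o`, whose
composition constraints are indexed by commutative triangles. -/
structure Base (E : Type u) [Category.{v} E] (C : Type u₁) [Bicategory.{w₁, v₁} C]
    (o : E → C) where
  map {X Y : E} (f : X ⟶ Y) : o X ⟶ o Y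
  mu {X Y Z : E} {f : X ⟶ Y} {g : Y ⟶ Z} {k : X ⟶ Z} (h : f ≫ g = k) : map k ≅ map f ≫ map g
  unit (X : E) : map (𝟙 X) ≅ 𝟙 (o X)
  mu_assoc {W X Y Z : E} {f : W ⟶ X} {g : X ⟶ Y} {h : Y ⟶ Z} {fg : W ⟶ Y} {gh : X ⟶ Z}
    {fgh : W ⟶ Z} (h₁ : f ≫ g = fg) (h₂ : g ≫ h = gh) (h₃ : fg ≫ h = fgh) (h₄ : f ≫ gh = fgh) :
    (mu h₃).hom ≫ (mu h₁).hom ▷ map h ≫ (α_ _ _ _).hom = (mu h₄).hom ≫ map f ◁ (mu h₂).hom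
  mu_id_left {X Y : E} {f : X ⟶ Y} (h : 𝟙 X ≫ f = f) :
    (mu h).hom ≫ (unit X).hom ▷ map f ≫ (λ_ _).hom = 𝟙 _
  mu_id_right {X Y : E} {f : X ⟶ Y} (h : f ≫ 𝟙 Y = f) :
    (mu h).hom ≫ map f ◁ (unit Y).hom ≫ (ρ_ _).hom = 𝟙 _

namespace Base

variable {E : Type u} [Category.{v} E] {C : Type u₁} [Bicategory.{w₁, v₁} C] {o : E → C}
  (F : Base E C o)

lemma mu_hom_of_id_left {X Y : E} {f : X ⟶ Y} (h : 𝟙 X ≫ f = f) :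
    (F.mu h).hom = (λ_ _).inv ≫ (F.unit X).inv ▷ _ := by
  rw [← cancel_mono ((F.unit X).hom ▷ F.map f ≫ (λ_ _).hom), F.mu_id_left]
  simp

lemma mu_inv_of_id_left {X Y : E} {f : X ⟶ Y} (h : 𝟙 X ≫ f = f) :
    (F.mu h).inv = (F.unit X).hom ▷ _ ≫ (λ_ _).hom := by
  rw [← cancel_epi (F.mu h).hom, Iso.hom_inv_id, F.mu_id_left]

lemma mu_hom_of_id_right {X Y : E} {f : X ⟶ Y} (h : f ≫ 𝟙 Y = f) :
    (F.mu h).hom = (ρ_ _).inv ≫ _ ◁ (F.unit Y).inv := by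
  rw [← cancel_mono (F.map f ◁ (F.unit Y).hom ≫ (ρ_ _).hom), F.mu_id_right]
  simp

lemma mu_inv_of_id_right {X Y : E} {f : X ⟶ Y} (h : f ≫ 𝟙 Y = f) :
    (F.mu h).inv = _ ◁ (F.unit Y).hom ≫ (ρ_ _).hom := by
  rw [← cancel_epi (F.mu h).hom, Iso.hom_inv_id, F.mu_id_right]

/-! ### Restriction of cells along morphisms of the base -/

variable {A A' A'' X Y Z : E} {x'' : A'' ⟶ X} {y'' : A'' ⟶ Y} {x' : A' ⟶ X} {y' : A' ⟶ Y}
  {z' : A' ⟶ Z} {x : A ⟶ X} {y : A ⟶ Y} {z : A ⟶ Z}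

/-- The restriction along `c : A' ⟶ A` of a 2-cell `F y ⟶ F x ≫ m`, where `x` and `y` are
morphisms out of `A`. -/
def restr (c : A' ⟶ A) (hx : c ≫ x = x') (hy : c ≫ y = y') {m : o X ⟶ o Y}
    (q : F.map y ⟶ F.map x ≫ m) : F.map y' ⟶ F.map x' ≫ m :=
  (F.mu hy).hom ≫ F.map c ◁ q ≫ (α_ _ _ _).inv ≫ (F.mu hx).inv ▷ m

lemma restr_eq (c : A' ⟶ A) (hx : c ≫ x = x') (hy : c ≫ y = y') {m : o X ⟶ o Y}
    {q : F.map y ⟶ F.map x ≫ m} {q' : F.map y' ⟶ F.map x' ≫ m}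
    (h : (F.mu hy).hom ≫ F.map c ◁ q = q' ≫ (F.mu hx).hom ▷ m ≫ (α_ _ _ _).hom) :
    F.restr c hx hy q = q' := by
  simp [restr, reassoc_of% h]

lemma restr_comp (c : A' ⟶ A) (hx : c ≫ x = x') (hy : c ≫ y = y') {m m' : o X ⟶ o Y}
    (q : F.map y ⟶ F.map x ≫ m) (θ : m ⟶ m') :
    F.restr c hx hy (q ≫ F.map x ◁ θ) = F.restr c hx hy q ≫ F.map x' ◁ θ := by
  simp only [restr, whiskerLeft_comp, Category.assoc, ← whisker_exchange,
    associator_inv_naturality_right_assoc]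

/-- The constraint for the middle leg occurs next to its inverse and cancels. -/
lemma restr_paste (c : A' ⟶ A) (hx : c ≫ x = x') (hy : c ≫ y = y') (hz : c ≫ z = z')
    {m : o X ⟶ o Y} {n : o Y ⟶ o Z} (q : F.map y ⟶ F.map x ≫ m) (q' : F.map z ⟶ F.map y ≫ n) :
    F.restr c hx hz (paste q q') = paste (F.restr c hx hy q) (F.restr c hy hz q') := by
  simp [restr, paste]

lemma restr_unit (c : A' ⟶ A) (hx : c ≫ x = x') :
    F.restr c hx hx (ρ_ (F.map x)).inv = (ρ_ _).inv := by
  simp only [restr]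
  calc
    _ = ((F.mu hx).hom ≫ (F.mu hx).inv) ⊗≫ 𝟙 _ := by bicategory
    _ = _ := by rw [Iso.hom_inv_id]; bicategory

/-- Associativity of the constraints is used once for the target leg and once, inverted, for the
source leg. -/
lemma restr_restr (c : A' ⟶ A) (c' : A'' ⟶ A') {c'' : A'' ⟶ A} (hc : c' ≫ c = c'')
    (hx : c ≫ x = x') (hy : c ≫ y = y') (hx' : c' ≫ x' = x'') (hy' : c' ≫ y' = y'')
    (hx'' : c'' ≫ x = x'') (hy'' : c'' ≫ y = y'') {m : o X ⟶ o Y} (q : F.map y ⟶ F.map x ≫ m) :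
    F.restr c' hx' hy' (F.restr c hx hy q) = F.restr c'' hx'' hy'' q := by
  have e₁ := F.mu_assoc hc hy hy'' hy'
  have e₂ : (F.mu hx'').inv = (F.mu hc).hom ▷ F.map x ≫ (α_ _ _ _).hom ≫
      F.map c' ◁ (F.mu hx).inv ≫ (F.mu hx').inv := by
    rw [← cancel_epi (F.mu hx'').hom, Iso.hom_inv_id]
    simp [reassoc_of% F.mu_assoc hc hx hx'' hx']
  simp only [restr, whiskerLeft_comp, Category.assoc]
  rw [← reassoc_of% e₁, e₂]
  simp only [comp_whiskerRight]
  rw [← associator_inv_naturality_left_assoc, whisker_exchange_assoc]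
  simp

lemma restr_id (hx : 𝟙 A ≫ x = x) (hy : 𝟙 A ≫ y = y) {m : o X ⟶ o Y}
    (q : F.map y ⟶ F.map x ≫ m) : F.restr (𝟙 A) hx hy q = q := by
  simp only [restr, mu_hom_of_id_left, mu_inv_of_id_left]
  simp [← whisker_exchange_assoc]

/-- A pseudofunctor sends isomorphisms to equivalences. -/
noncomputable def equivalenceOfIsIso (c : A' ⟶ A) [IsIso c] : o A' ≌ o A :=
  Bicategory.Equivalence.mkOfAdjointifyCounit (f := F.map c) (g := F.map (inv c))
    ((F.unit _).symm ≪≫ F.mu (IsIso.hom_inv_id c))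
    ((F.mu (IsIso.inv_hom_id c)).symm ≪≫ F.unit _)

lemma isUniv_iff_isIso (c : A' ⟶ A) [IsIso c] {Y : C} {k : o A' ⟶ Y} {m : o A ⟶ Y}
    (q : k ⟶ F.map c ≫ m) : IsUniv q ↔ IsIso q :=
  SpanUP.isUniv_iff_isIso (F.equivalenceOfIsIso c) q

/-- Since `F c` is an equivalence, an identity cell along it is universal, and universal cells
compose. -/
lemma isUniv_restr (c : A' ⟶ A) [IsIso c] (hx : c ≫ x = x') (hy : c ≫ y = y') {m : o X ⟶ o Y}
    {q : F.map y ⟶ F.map x ≫ m} (h : IsUniv q) : IsUniv (F.restr c hx hy q) := by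
  have h₁ : IsUniv (𝟙 (F.map c ≫ F.map y)) := (F.isUniv_iff_isIso c _).2 inferInstance
  have h₂ := ((h₁.trans h).comp_isIso_whiskerRight (F.mu hx).inv).isIso_comp (F.mu hy).hom
  simpa [restr] using h₂

section Sinister

variable [∀ {X Y : E} (f : X ⟶ Y), IsLeftAdjoint (F.map f)]

/-- The universal cell `F t ⟶ F s ≫ (F s)^* ≫ F t` of a span with legs `s` and `t`. -/
noncomputable def unitCell {X Y : E} (S : Sp X Y) :
    F.map S.r ⟶ F.map S.l ≫ rightAdjoint (F.map S.l) ≫ F.map S.r :=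
  (Adjunction.ofIsLeftAdjoint (F.map S.l)).homEquiv₁.symm (𝟙 _)

lemma isUniv_unitCell {X Y : E} (S : Sp X Y) : IsUniv (F.unitCell S) :=
  isUniv_homEquiv₁_symm _ _

end Sinister

/-! ### Beck cells and pasting along a square -/

section Beck

variable {P X Y Z : E} {f' : P ⟶ X} {g' : P ⟶ Y} {g : X ⟶ Z} {f : Y ⟶ Z} {y : P ⟶ Z}
  (h₁ : f' ≫ g = y) (h₂ : g' ≫ f = y) {r : o Z ⟶ o X} (adj : F.map g ⊣ r)

/-- The transpose of the Beck cell of a commutative square along `F g'`. -/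
def beck : F.map f' ⟶ F.map g' ≫ F.map f ≫ r :=
  adj.homEquiv₂ ((F.mu h₁).inv ≫ (F.mu h₂).hom) ≫ (α_ _ _ _).hom

/-- As `F g` is an equivalence, the unit of `adj` is invertible, hence so is the whole cell; along
the equivalence `F g'`, invertible means universal. -/
lemma isUniv_beck_of_isIso [IsIso g] [IsIso g'] : IsUniv (F.beck h₁ h₂ adj) := by
  rw [F.isUniv_iff_isIso]
  have := (F.isUniv_iff_isIso g adj.unit).1 (isUniv_unit adj)
  rw [beck, Adjunction.homEquiv₂_apply]
  infer_instance

end Beck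

/-- If the Beck cell of a square is universal, then so is the pasting of universal cells along
the square. -/
lemma isUniv_paste_restr {P T U X Y Z : E} {p₁ : P ⟶ T} {p₂ : P ⟶ U} {s : T ⟶ X} {t : T ⟶ Y}
    {u : U ⟶ Y} {v : U ⟶ Z} {x : P ⟶ X} {y : P ⟶ Y} {z : P ⟶ Z} (hx : p₁ ≫ s = x)
    (h₂ : p₁ ≫ t = y) (h₁ : p₂ ≫ u = y) (hz : p₂ ≫ v = z) {m : o X ⟶ o Y} {n : o Y ⟶ o Z}
    {q : F.map t ⟶ F.map s ≫ m} (hq : IsUniv q) {q' : F.map v ⟶ F.map u ≫ n} (hq' : IsUniv q')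
    [IsLeftAdjoint (F.map s)] [IsLeftAdjoint (F.map p₁)] {r : o Y ⟶ o U} (adj : F.map u ⊣ r)
    (hb : IsUniv (F.beck h₁ h₂ adj)) :
    IsUniv (paste (F.restr p₁ hx h₂ q) (F.restr p₂ h₁ hz q')) := by
  have := (isUniv_iff adj q').1 hq'
  -- Universality presents `q'` as the unit of `adj` followed by an invertible `θ : r ≫ F v ⟶ n`,
  -- which lets the Beck cell appear in the pasting.
  obtain ⟨θ, rfl⟩ := adj.homEquiv₁.symm.surjective q'
  rw [Equiv.apply_symm_apply] at this
  -- Both universal cells are absolute, being along left adjoints: the Beck cell is whiskered by `F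
  -- v`, then `q` by `n`, and the results compose.
  have h₃ := (hb.whiskerRight (F.map v)).comp_isIso ((α_ _ _ _).hom ≫ F.map t ◁ θ)
  have h₄ := ((h₃.trans (hq.whiskerRight n)).comp_isIso_whiskerRight
    (F.mu hx).inv).isIso_comp (F.mu hz).hom
  convert h₄ using 1
  simp only [paste, restr, beck, Adjunction.homEquiv₂_apply, Adjunction.homEquiv₁_symm_apply]
  calc
    _ = (F.mu hz).hom ⊗≫ F.map p₂ ◁ adj.unit ▷ F.map v ⊗≫
          ((F.map p₂ ≫ F.map u) ◁ θ ≫ ((F.mu h₁).inv ≫ (F.mu h₂).hom) ▷ n) ⊗≫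
          F.map p₁ ◁ q ▷ n ⊗≫ (F.mu hx).inv ▷ (m ≫ n) := by bicategory
    _ = _ := by rw [whisker_exchange]; bicategory

end Base

end SpanUP

namespace SpanUP

/-! ### Extensions of a pseudofunctor to spans -/

section Extension

variable {E : Type u} [Category.{v} E] [PullbackChoice E] {C : Type u₁} [Bicategory.{w₁, v₁} C]
  {o : E → C}

/-- An extension of a pseudofunctor `F` to spans: for every span `X ⟵ T ⟶ Y` with legs `s` and `t`
a left extension of `F t` along `F s`, together with the cells `F (a ≫ t) ⟶ F (a ≫ s) ≫ map S`
obtained by restriction, and the oplax structure that these determine. -/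
structure Extension (F : Base E C o) where
  map {X Y : E} (S : Sp X Y) : o X ⟶ o Y
  map₂ {X Y : E} {S T : Sp X Y} (h : S ⟶ T) : map S ⟶ map T
  mapComp {X Y Z : E} (S : Sp X Y) (T : Sp Y Z) : map (S.comp T) ⟶ map S ≫ map T
  mapId (X : E) : map (Sp.mk (𝟙 X) (𝟙 X)) ⟶ 𝟙 (o X)
  cell {X Y : E} (S : Sp X Y) {A : E} (a : A ⟶ S.apex) {x : A ⟶ X} {y : A ⟶ Y}
    (hx : a ≫ S.l = x) (hy : a ≫ S.r = y) : F.map y ⟶ F.map x ≫ map S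
  restr_cell {X Y : E} (S : Sp X Y) {A A' : E} (c : A' ⟶ A) (a : A ⟶ S.apex) {a' : A' ⟶ S.apex}
    (ha : c ≫ a = a') {x : A ⟶ X} {y : A ⟶ Y} {x' : A' ⟶ X} {y' : A' ⟶ Y}
    (hx : a ≫ S.l = x) (hy : a ≫ S.r = y) (hx' : a' ≫ S.l = x') (hy' : a' ≫ S.r = y')
    (hcx : c ≫ x = x') (hcy : c ≫ y = y') :
    F.restr c hcx hcy (cell S a hx hy) = cell S a' hx' hy'
  cell_map₂ {X Y : E} {S T : Sp X Y} (h : S ⟶ T) {A : E} (a : A ⟶ S.apex) {a' : A ⟶ T.apex}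
    (ha : a ≫ h.hom = a') {x : A ⟶ X} {y : A ⟶ Y} (hx : a ≫ S.l = x) (hy : a ≫ S.r = y)
    (hx' : a' ≫ T.l = x) (hy' : a' ≫ T.r = y) :
    cell S a hx hy ≫ F.map x ◁ map₂ h = cell T a' hx' hy'
  cell_mapComp {X Y Z : E} (S : Sp X Y) (T : Sp Y Z) {A : E} (a : A ⟶ (S.comp T).apex)
    {a₁ : A ⟶ S.apex} {a₂ : A ⟶ T.apex} (ha₁ : a ≫ (pb S.r T.l).p₁ = a₁)
    (ha₂ : a ≫ (pb S.r T.l).p₂ = a₂) {x : A ⟶ X} {y : A ⟶ Y} {z : A ⟶ Z}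
    (hx : a ≫ (S.comp T).l = x) (hz : a ≫ (S.comp T).r = z) (hx₁ : a₁ ≫ S.l = x)
    (hy₁ : a₁ ≫ S.r = y) (hy₂ : a₂ ≫ T.l = y) (hz₂ : a₂ ≫ T.r = z) :
    cell (S.comp T) a hx hz ≫ F.map x ◁ mapComp S T = paste (cell S a₁ hx₁ hy₁) (cell T a₂ hy₂ hz₂)
  cell_mapId {X A : E} (a : A ⟶ X) {x : A ⟶ X} (hx : a ≫ 𝟙 X = x) :
    cell (Sp.mk (𝟙 X) (𝟙 X)) a hx hx ≫ F.map x ◁ mapId X = (ρ_ (F.map x)).inv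
  isUniv_cell {X Y : E} (S : Sp X Y) :
    IsUniv (cell S (𝟙 S.apex) (Category.id_comp S.l) (Category.id_comp S.r))

namespace Extension

variable {F : Base E C o} (G : Extension F)

lemma cell_map₂_assoc {X Y : E} {S T : Sp X Y} (h : S ⟶ T) {A : E} (a : A ⟶ S.apex)
    {a' : A ⟶ T.apex} (ha : a ≫ h.hom = a') {x : A ⟶ X} {y : A ⟶ Y} (hx : a ≫ S.l = x)
    (hy : a ≫ S.r = y) (hx' : a' ≫ T.l = x) (hy' : a' ≫ T.r = y) {n : o A ⟶ o Y}
    (φ : F.map x ≫ G.map T ⟶ n) :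
    G.cell S a hx hy ≫ F.map x ◁ G.map₂ h ≫ φ = G.cell T a' hx' hy' ≫ φ := by
  rw [← Category.assoc, G.cell_map₂ h a ha hx hy hx' hy']

lemma cell_mapComp_assoc {X Y Z : E} (S : Sp X Y) (T : Sp Y Z) {A : E} (a : A ⟶ (S.comp T).apex)
    {a₁ : A ⟶ S.apex} {a₂ : A ⟶ T.apex} (ha₁ : a ≫ (pb S.r T.l).p₁ = a₁)
    (ha₂ : a ≫ (pb S.r T.l).p₂ = a₂) {x : A ⟶ X} {y : A ⟶ Y} {z : A ⟶ Z}
    (hx : a ≫ (S.comp T).l = x) (hz : a ≫ (S.comp T).r = z) (hx₁ : a₁ ≫ S.l = x)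
    (hy₁ : a₁ ≫ S.r = y) (hy₂ : a₂ ≫ T.l = y) (hz₂ : a₂ ≫ T.r = z) {n : o A ⟶ o Z}
    (φ : F.map x ≫ G.map S ≫ G.map T ⟶ n) :
    G.cell (S.comp T) a hx hz ≫ F.map x ◁ G.mapComp S T ≫ φ =
      paste (G.cell S a₁ hx₁ hy₁) (G.cell T a₂ hy₂ hz₂) ≫ φ := by
  rw [← Category.assoc, G.cell_mapComp S T a ha₁ ha₂ hx hz hx₁ hy₁ hy₂ hz₂]

lemma hom_ext {X Y : E} {S : Sp X Y} {m : o X ⟶ o Y} {θ θ' : G.map S ⟶ m}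
    (h : G.cell S (𝟙 S.apex) (Category.id_comp S.l) (Category.id_comp S.r) ≫ F.map S.l ◁ θ =
      G.cell S (𝟙 S.apex) (Category.id_comp S.l) (Category.id_comp S.r) ≫ F.map S.l ◁ θ') :
    θ = θ' :=
  (G.isUniv_cell S).hom_ext h

/-! ### Coherence of the oplax structure -/

section Laws

variable {W X Y Z : E}

lemma map₂_id (S : Sp X Y) : G.map₂ (𝟙 S) = 𝟙 (G.map S) := by
  apply G.hom_ext
  rw [G.cell_map₂ (𝟙 S) (𝟙 _) (a' := 𝟙 _) (by simp)]
  · simp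
  all_goals simp

lemma map₂_comp {S T U : Sp X Y} (h : S ⟶ T) (k : T ⟶ U) :
    G.map₂ (h ≫ k) = G.map₂ h ≫ G.map₂ k := by
  apply G.hom_ext
  rw [G.cell_map₂ (h ≫ k) (𝟙 _) (a' := h.hom ≫ k.hom) (by simp) (hx' := by simp) (hy' := by simp),
    whiskerLeft_comp,
    G.cell_map₂_assoc h (𝟙 _) (a' := h.hom) (by simp) (hx' := by simp) (hy' := by simp),
    G.cell_map₂ k h.hom (a' := h.hom ≫ k.hom) rfl]

/-- As in the other laws, both sides are evaluated on the universal cell. The axioms for `cell` then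
only track where the identity of the apex is sent under the projections. -/
lemma mapComp_naturality_left {S S' : Sp X Y} (h : S ⟶ S') (T : Sp Y Z) :
    G.map₂ (Sp.whiskerRight h T) ≫ G.mapComp S' T = G.mapComp S T ≫ G.map₂ h ▷ G.map T := by
  apply G.hom_ext
  simp only [whiskerLeft_comp]
  rw [G.cell_map₂_assoc (Sp.whiskerRight h T) (𝟙 _) (a' := (Sp.whiskerRight h T).hom)
      (by simp) (hx' := by simp) (hy' := by simp),
    G.cell_mapComp S' T _ (a₁ := (pb S.r T.l).p₁ ≫ h.hom) (a₂ := (pb S.r T.l).p₂)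
      (y := (pb S.r T.l).p) (by simp) (by simp) (hx₁ := by simp) (hy₁ := by simp)
      (hy₂ := by simp) (hz₂ := by simp),
    G.cell_mapComp_assoc S T _ (a₁ := (pb S.r T.l).p₁) (a₂ := (pb S.r T.l).p₂)
      (y := (pb S.r T.l).p) (by simp) (by simp) (hx₁ := by simp) (hy₁ := by simp)
      (hy₂ := by simp) (hz₂ := by simp),
    ← paste_comp_left, G.cell_map₂ h _ rfl]

lemma mapComp_naturality_right (S : Sp X Y) {T T' : Sp Y Z} (h : T ⟶ T') :
    G.map₂ (Sp.whiskerLeft S h) ≫ G.mapComp S T' = G.mapComp S T ≫ G.map S ◁ G.map₂ h := by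
  apply G.hom_ext
  simp only [whiskerLeft_comp]
  rw [G.cell_map₂_assoc (Sp.whiskerLeft S h) (𝟙 _) (a' := (Sp.whiskerLeft S h).hom)
      (by simp) (hx' := by simp) (hy' := by simp),
    G.cell_mapComp S T' _ (a₁ := (pb S.r T.l).p₁) (a₂ := (pb S.r T.l).p₂ ≫ h.hom)
      (y := (pb S.r T.l).p) (by simp) (by simp) (hx₁ := by simp) (hy₁ := by simp)
      (hy₂ := by simp) (hz₂ := by simp),
    G.cell_mapComp_assoc S T _ (a₁ := (pb S.r T.l).p₁) (a₂ := (pb S.r T.l).p₂)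
      (y := (pb S.r T.l).p) (by simp) (by simp) (hx₁ := by simp) (hy₁ := by simp)
      (hy₂ := by simp) (hz₂ := by simp),
    ← paste_comp_right, G.cell_map₂ h _ rfl]

/-- Both sides evaluate to the pasting of the same three cells, indexed by the projections of the
iterated pullback to `S`, `T` and `U`. -/
lemma map₂_associator (S : Sp W X) (T : Sp X Y) (U : Sp Y Z) :
    G.map₂ (Sp.associator S T U).hom ≫ G.mapComp S (T.comp U) ≫ G.map S ◁ G.mapComp T U =
      G.mapComp (S.comp T) U ≫ G.mapComp S T ▷ G.map U ≫ (α_ _ _ _).hom := by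
  apply G.hom_ext
  simp only [whiskerLeft_comp]
  let π := pb (S.comp T).r U.l
  let π' := pb S.r T.l
  rw [G.cell_map₂_assoc (Sp.associator S T U).hom (𝟙 _) (a' := (Sp.associator S T U).hom.hom)
      (by simp) (hx' := by simp) (hy' := by simp),
    G.cell_mapComp_assoc S (T.comp U) _ (a₁ := π.p₁ ≫ π'.p₁)
      (a₂ := plift (π.p₁ ≫ π'.p₂) π.p₂ (by simp [π, π'])) (y := π.p₁ ≫ π'.p)
      (by simp [π, π']) (by simp [π, π']) (hx₁ := by simp [π, π']) (hy₁ := by simp [π, π'])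
      (hy₂ := by simp [π, π']) (hz₂ := by simp [π, π']),
    ← paste_comp_right,
    G.cell_mapComp T U _ (a₁ := π.p₁ ≫ π'.p₂) (a₂ := π.p₂) (y := π.p)
      (by simp) (by simp) (hx₁ := by simp [π, π']) (hy₁ := by simp [π, π'])
      (hy₂ := by simp [π]) (hz₂ := by simp [π]),
    G.cell_mapComp_assoc (S.comp T) U _ (a₁ := π.p₁) (a₂ := π.p₂) (y := π.p)
      (by simp [π]) (by simp [π]) (hx₁ := by simp [π]) (hy₁ := by simp [π])
      (hy₂ := by simp [π]) (hz₂ := by simp [π]),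
    ← reassoc_of% paste_comp_left,
    G.cell_mapComp S T _ (a₁ := π.p₁ ≫ π'.p₁) (a₂ := π.p₁ ≫ π'.p₂) (y := π.p₁ ≫ π'.p)
      rfl rfl (hx₁ := by simp [π, π']) (hy₁ := by simp [π, π'])
      (hy₂ := by simp [π, π']) (hz₂ := by simp [π, π']),
    paste_assoc]

lemma map₂_leftUnitor (S : Sp X Y) :
    G.map₂ S.leftUnitor.hom =
      G.mapComp (Sp.mk (𝟙 X) (𝟙 X)) S ≫ G.mapId X ▷ G.map S ≫ (λ_ _).hom := by
  apply G.hom_ext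
  simp only [whiskerLeft_comp]
  rw [G.cell_map₂ S.leftUnitor.hom _ (a' := (pb (𝟙 X) S.l).p₂) (by simp)
      (hx' := (pb (𝟙 X) S.l).condition.symm)
      (hy' := by simp),
    G.cell_mapComp_assoc (Sp.mk (𝟙 X) (𝟙 X)) S _ (a₁ := (pb (𝟙 X) S.l).p₁)
      (a₂ := (pb (𝟙 X) S.l).p₂) (y := (pb (𝟙 X) S.l).p₁ ≫ 𝟙 X) (by simp) (by simp)
      (hx₁ := by simp) (hy₁ := by simp) (hy₂ := (pb (𝟙 X) S.l).condition.symm) (hz₂ := by simp),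
    ← reassoc_of% paste_comp_left, G.cell_mapId, paste_unit_left]

lemma map₂_rightUnitor (S : Sp X Y) :
    G.map₂ S.rightUnitor.hom =
      G.mapComp S (Sp.mk (𝟙 Y) (𝟙 Y)) ≫ G.map S ◁ G.mapId Y ≫ (ρ_ _).hom := by
  apply G.hom_ext
  simp only [whiskerLeft_comp]
  rw [G.cell_map₂ S.rightUnitor.hom _ (a' := (pb S.r (𝟙 Y)).p₁) (by simp) (hx' := by simp)
      (hy' := (pb S.r (𝟙 Y)).condition),
    G.cell_mapComp_assoc S (Sp.mk (𝟙 Y) (𝟙 Y)) _ (a₁ := (pb S.r (𝟙 Y)).p₁)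
      (a₂ := (pb S.r (𝟙 Y)).p₂) (y := (pb S.r (𝟙 Y)).p₂ ≫ 𝟙 Y) (by simp) (by simp)
      (hx₁ := by simp) (hy₁ := (pb S.r (𝟙 Y)).condition) (hy₂ := by simp) (hz₂ := by simp),
    ← reassoc_of% paste_comp_right, G.cell_mapId, paste_unit_right]

end Laws

/-- The oplax functor on spans underlying an extension. -/
def toOplax : SpanBicat E ⥤ᵒᵖᴸ C where
  obj X := o X.as
  map S := G.map S
  map₂ h := G.map₂ h
  map₂_id S := G.map₂_id S
  map₂_comp h k := G.map₂_comp h k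
  mapId X := G.mapId X.as
  mapComp S T := G.mapComp S T
  mapComp_naturality_left h T := G.mapComp_naturality_left h T
  mapComp_naturality_right S _ _ h := G.mapComp_naturality_right S h
  map₂_associator S T U := G.map₂_associator S T U
  map₂_leftUnitor S := G.map₂_leftUnitor S
  map₂_rightUnitor S := G.map₂_rightUnitor S

/-! ### Invertibility of the constraints and the Beck cells -/

lemma isIso_mapId (X : E) : IsIso (G.mapId X) :=
  (G.isUniv_cell (Sp.mk (𝟙 X) (𝟙 X))).isIso ((F.isUniv_iff_isIso (𝟙 X) _).2 inferInstance) _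
    (G.cell_mapId (𝟙 X) (Category.comp_id _))

/-- The constraint carries the universal cell of the composite to a pasting of restricted cells,
which is universal too. -/
lemma isIso_mapComp_of_beck [∀ {X Y : E} (f : X ⟶ Y), IsLeftAdjoint (F.map f)] {X Y Z : E}
    (S : Sp X Y) (T : Sp Y Z) {r : o Y ⟶ o T.apex} (adj : F.map T.l ⊣ r)
    (h : IsUniv (F.beck (pb S.r T.l).hp₂ (pb S.r T.l).hp₁ adj)) : IsIso (G.mapComp S T) := by
  refine (G.isUniv_cell (S.comp T)).isIso (F.isUniv_paste_restr (x := (S.comp T).l)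
    (z := (S.comp T).r) rfl (pb S.r T.l).hp₁ (pb S.r T.l).hp₂ rfl (G.isUniv_cell S)
    (G.isUniv_cell T) adj h) _ ?_
  rw [G.restr_cell S _ _ (Category.comp_id _) (hx' := rfl) (hy' := by simp),
    G.restr_cell T _ _ (Category.comp_id _) (hx' := by simp) (hy' := rfl)]
  exact G.cell_mapComp S T _ (Category.id_comp _) (Category.id_comp _) _ _ _ _ _ _

/-- Pulling back an isomorphism gives an isomorphism, and for such squares the Beck cell is always
universal. This is what makes the extension gregarious. -/
lemma isIso_mapComp_of_isIso [∀ {X Y : E} (f : X ⟶ Y), IsLeftAdjoint (F.map f)] {X Y Z : E}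
    (S : Sp X Y) (T : Sp Y Z) [IsIso T.l] : IsIso (G.mapComp S T) := by
  have : IsIso (pb S.r T.l).p₁ := (pb S.r T.l).isPullback.isIso_fst_of_isIso
  exact G.isIso_mapComp_of_beck S T (Adjunction.ofIsLeftAdjoint _) (F.isUniv_beck_of_isIso _ _ _)

lemma isUniv_cell_of_isIso {X Y : E} (S : Sp X Y) {A : E} (a : A ⟶ S.apex) [IsIso a] {x : A ⟶ X}
    {y : A ⟶ Y} (hx : a ≫ S.l = x) (hy : a ≫ S.r = y) : IsUniv (G.cell S a hx hy) := by
  rw [← G.restr_cell S a (𝟙 _) (Category.comp_id a) (Category.id_comp _) (Category.id_comp _)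
    hx hy hx hy]
  exact F.isUniv_restr a hx hy (G.isUniv_cell S)

/-- The comparison of the value of `F` at `f` with that of its extension at the span of `f`. -/
def sigmaCell {X Y : E} (f : X ⟶ Y) : F.map f ⟶ G.map (Sp.mk (𝟙 X) f) :=
  G.cell (Sp.mk (𝟙 X) f) (𝟙 X) (Category.id_comp _) (Category.id_comp _) ≫
    (F.unit X).hom ▷ _ ≫ (λ_ _).hom

lemma cell_sigma {A X Y : E} (f : X ⟶ Y) (a : A ⟶ X) {y : A ⟶ Y} (hx : a ≫ 𝟙 X = a)
    (hy : a ≫ f = y) :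
    G.cell (Sp.mk (𝟙 X) f) a hx hy = (F.mu hy).hom ≫ F.map a ◁ G.sigmaCell f := by
  rw [← G.restr_cell (Sp.mk (𝟙 X) f) a (𝟙 X) (Category.comp_id a) (Category.id_comp _)
    (Category.id_comp _) hx hy hx hy, Base.restr, F.mu_inv_of_id_right, sigmaCell]
  bicategory

lemma isIso_sigmaCell {X Y : E} (f : X ⟶ Y) : IsIso (G.sigmaCell f) := by
  have := (F.isUniv_iff_isIso (𝟙 X) _).1 (G.isUniv_cell (Sp.mk (𝟙 X) f))
  rw [sigmaCell]
  infer_instance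

/-- The invertible constraint makes the pasting of the cells of `f_Σ` and of the reversed span of
`g` universal over the pullback. Up to isomorphism this pasting is the Beck cell. -/
lemma isUniv_beck {P X Y Z : E} {f' : P ⟶ X} {g' : P ⟶ Y} {g : X ⟶ Z} {f : Y ⟶ Z} {y : P ⟶ Z}
    (sq : IsPullback f' g' g f) (h₁ : f' ≫ g = y) (h₂ : g' ≫ f = y) {r : o Z ⟶ o X}
    (adj : F.map g ⊣ r) [IsIso (G.mapComp (Sp.mk (𝟙 Y) f) (Sp.mk g (𝟙 X)))] :
    IsUniv (F.beck h₁ h₂ adj) := by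
  let S := Sp.mk (𝟙 Y) f
  let T := Sp.mk g (𝟙 X)
  let c := (sq.flip.isoIsPullback _ _ (pb f g).isPullback).hom
  have hc₁ : c ≫ (pb f g).p₁ = g' := IsPullback.isoIsPullback_hom_fst ..
  have hc₂ : c ≫ (pb f g).p₂ = f' := IsPullback.isoIsPullback_hom_snd ..
  have hu := G.isUniv_cell_of_isIso (S.comp T) c (x := g') (y := f') (by simp [S, T, hc₁])
    (by simp [S, T, hc₂])
  have hu' := hu.comp_isIso (G.mapComp S T)
  rw [G.cell_mapComp S T c (y := y) hc₁ hc₂ (hx₁ := by simp [S]) (hy₁ := h₂) (hy₂ := h₁)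
    (hz₂ := by simp [T])] at hu'
  have hS := G.isIso_sigmaCell f
  have hT := (G.isUniv_cell T).isIso_comp (F.unit X).inv
  -- The unit of `adj` and the normalized cell of `T` are both universal out of `𝟙` along `F g`, so
  -- they differ by an isomorphism `θ`.
  let θ := (isUniv_unit adj).desc
    ((F.unit X).inv ≫ G.cell T (𝟙 X) (Category.id_comp _) (Category.id_comp _))
  have : IsIso θ := (isUniv_unit adj).isIso hT θ (IsUniv.fac _ _)
  have eT : G.cell T (𝟙 X) (Category.id_comp _) (Category.id_comp _) =
      ((F.unit X).hom ≫ adj.unit) ≫ F.map g ◁ θ := by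
    simp [θ]
  have eT' : G.cell T f' h₁ (Category.comp_id _) =
      ((ρ_ _).inv ≫ F.map f' ◁ adj.unit ≫ (α_ _ _ _).inv ≫ (F.mu h₁).inv ▷ r) ≫ F.map y ◁ θ := by
    rw [← G.restr_cell T f' (𝟙 X) (Category.comp_id f') (Category.id_comp _)
      (Category.id_comp _) h₁ (Category.comp_id _) h₁ (Category.comp_id _), eT, F.restr_comp,
      Base.restr, F.mu_hom_of_id_right]
    simp [T]
  rw [eT', paste_comp_right, G.cell_sigma, paste_comp_left, Category.assoc,
    ← whiskerLeft_comp] at hu'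
  convert hu'.of_comp_isIso using 1
  simp [Base.beck, paste, Adjunction.homEquiv₂_apply]

/-! ### The extension of a sinister pseudofunctor -/

section OfSinister

variable (F : Base E C o) [∀ {X Y : E} (f : X ⟶ Y), IsLeftAdjoint (F.map f)]

/-- The extension of a sinister pseudofunctor to spans, sending a span with legs `s` and `t` to
`(F s)^* ≫ F t`. -/
noncomputable def ofSinister : Extension F where
  map S := rightAdjoint (F.map S.l) ≫ F.map S.r
  map₂ {_ _ S T} h := (F.isUniv_unitCell S).desc (F.restr h.hom h.hom_l h.hom_r (F.unitCell T))
  mapComp S T := (F.isUniv_unitCell (S.comp T)).desc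
    (paste (F.restr (pb S.r T.l).p₁ rfl (pb S.r T.l).hp₁ (F.unitCell S))
      (F.restr (pb S.r T.l).p₂ (pb S.r T.l).hp₂ rfl (F.unitCell T)))
  mapId X := (F.isUniv_unitCell (Sp.mk (𝟙 X) (𝟙 X))).desc (ρ_ _).inv
  -- Every cell is a restriction of one universal cell, so each axiom follows from its instance at
  -- the identity and functoriality of restriction.
  cell S _ a _ _ hx hy := F.restr a hx hy (F.unitCell S)
  restr_cell S _ _ c a _ ha _ _ _ _ hx hy hx' hy' hcx hcy :=
    F.restr_restr _ _ ha _ _ _ _ _ _ _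
  cell_map₂ {_ _ S T} h _ a _ ha _ _ hx hy hx' hy' := by
    rw [← F.restr_comp, IsUniv.fac]
    exact F.restr_restr _ _ ha _ _ _ _ _ _ _
  cell_mapComp S T _ a a₁ a₂ ha₁ ha₂ x y z hx hz hx₁ hy₁ hy₂ hz₂ := by
    rw [← F.restr_comp, IsUniv.fac, F.restr_paste a (y' := y)]
    · congr 1
      · exact F.restr_restr _ _ ha₁ _ _ _ _ _ _ _
      · exact F.restr_restr _ _ ha₂ _ _ _ _ _ _ _
    · rw [← (pb S.r T.l).hp₁, reassoc_of% ha₁, hy₁]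
  cell_mapId a _ hx := by
    rw [← F.restr_comp, IsUniv.fac, F.restr_unit]
  isUniv_cell S := by
    rw [F.restr_id]
    exact F.isUniv_unitCell S

end OfSinister

end Extension

end Extension

end SpanUP

namespace SpanUP

/-! ### Adjoints in the bicategory of spans -/

noncomputable section SpanAdjoints

lemma leftZigzag_eq {B : Type u₁} [Bicategory.{w₁, v₁} B] {a b : B} {f : a ⟶ b} {g : b ⟶ a}
    (η : 𝟙 a ⟶ f ≫ g) (κ : g ≫ f ⟶ 𝟙 b) :
    leftZigzag η κ = η ▷ f ≫ (α_ f g f).hom ≫ f ◁ κ := by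
  simp [leftZigzag, bicategoricalComp]

lemma rightZigzag_eq {B : Type u₁} [Bicategory.{w₁, v₁} B] {a b : B} {f : a ⟶ b} {g : b ⟶ a}
    (η : 𝟙 a ⟶ f ≫ g) (κ : g ≫ f ⟶ 𝟙 b) :
    rightZigzag η κ = g ◁ η ≫ (α_ g f g).inv ≫ κ ▷ g := by
  simp [rightZigzag, bicategoricalComp]

variable {E : Type u} [Category.{v} E] [PullbackChoice E]

lemma pb_id_p₁ (X : E) : (pb (𝟙 X) (𝟙 X)).p₁ = (pb (𝟙 X) (𝟙 X)).p₂ := by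
  have := (pb (𝟙 X) (𝟙 X)).condition
  rwa [Category.comp_id, Category.comp_id] at this

/-- The unit of the adjunction between the two spans given by `f`. -/
@[simps]
def sigmaUnit {X Y : E} (f : X ⟶ Y) :
    Sp.mk (𝟙 X) (𝟙 X) ⟶ (Sp.mk (𝟙 X) f).comp (Sp.mk f (𝟙 X)) where
  hom := plift (𝟙 X) (𝟙 X) rfl
  hom_l := by simp
  hom_r := by simp

/-- The counit of the adjunction between the two spans given by `f`. -/
@[simps]
def sigmaCounit {X Y : E} (f : X ⟶ Y) :
    (Sp.mk f (𝟙 X)).comp (Sp.mk (𝟙 X) f) ⟶ Sp.mk (𝟙 Y) (𝟙 Y) where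
  hom := (pb (𝟙 X) (𝟙 X)).p ≫ f
  hom_l := by simp [← (pb (𝟙 X) (𝟙 X)).hp₁]
  hom_r := by simp [← (pb (𝟙 X) (𝟙 X)).hp₂]

/-- The span `X ⟵ X ⟶ Y` with legs `𝟙` and `f` is left adjoint to the reversed span. -/
def sigmaAdj {X Y : E} (f : X ⟶ Y) :
    Bicategory.Adjunction (B := SpanBicat E) (a := ⟨X⟩) (b := ⟨Y⟩) (Sp.mk (𝟙 X) f)
      (Sp.mk f (𝟙 X)) where
  unit := sigmaUnit f
  counit := sigmaCounit f
  left_triangle := by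
    rw [leftZigzag_eq]
    change Sp.whiskerRight (sigmaUnit f) _ ≫ (Sp.associator _ _ _).hom ≫
      Sp.whiskerLeft _ (sigmaCounit f) = (Sp.leftUnitor _).hom ≫ (Sp.rightUnitor _).inv
    apply Span.hom_ext
    apply ChosenPullback.hom_ext
    · simp [pb_id_p₁]
    · simp [← (pb (𝟙 X) (𝟙 X)).hp₂]
  right_triangle := by
    rw [rightZigzag_eq]
    change Sp.whiskerLeft _ (sigmaUnit f) ≫ (Sp.associator _ _ _).inv ≫
      Sp.whiskerRight (sigmaCounit f) _ = (Sp.rightUnitor _).hom ≫ (Sp.leftUnitor _).inv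
    apply Span.hom_ext
    apply ChosenPullback.hom_ext
    · simp [← (pb (𝟙 X) (𝟙 X)).hp₁]
    · simp [pb_id_p₁]

/-- The left leg of a span that has a right adjoint is invertible. -/
lemma isIso_l_of_isLeftAdjoint {X Y : SpanBicat E} (T : X ⟶ Y) (hT : IsLeftAdjoint T) :
    IsIso (Span.l T) := by
  have adj := Adjunction.ofIsLeftAdjoint T
  generalize rightAdjoint T = V at adj
  obtain ⟨η, κ, h, -⟩ := adj
  rw [leftZigzag_eq] at h
  change Sp X.as Y.as at T
  change Sp Y.as X.as at V
  change Sp.mk (𝟙 X.as) (𝟙 X.as) ⟶ T.comp V at η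
  change V.comp T ⟶ Sp.mk (𝟙 Y.as) (𝟙 Y.as) at κ
  change Sp.whiskerRight η T ≫ (Sp.associator T V T).hom ≫ Sp.whiskerLeft T κ =
    T.leftUnitor.hom ≫ T.rightUnitor.inv at h
  -- The triangle identity is evaluated at the generalized element `(T.l, 𝟙)` of `𝟙 ≫ T` and
  -- projected to the apex of `T`; the counit does not affect this projection.
  have e := congrArg (fun k => plift T.l (𝟙 T.apex) (by simp) ≫ Span.Hom.hom k ≫
    (pb T.r (𝟙 Y.as)).p₁) h
  -- The unit, projected to the apex of `T`, is the inverse: a section by compatibility with the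
  -- left legs, a retraction by `e`.
  refine ⟨η.hom ≫ (pb T.r V.l).p₁, ?_, ?_⟩
  · simpa using e
  · simpa using η.hom_l

end SpanAdjoints

end SpanUP

namespace SpanUP

/-! ### Oplax functors and adjunctions -/

section OplaxAdj

variable {B : Type u₁} [Bicategory.{w₁, v₁} B] {C : Type u₂} [Bicategory.{w₂, v₂} C]

/-- A normal oplax functor `F` sends an adjunction `f ⊣ g` to an adjunction if its constraint at
`g` and `f` is invertible. -/
noncomputable def oplaxMapAdj (F : B ⥤ᵒᵖᴸ C) {a b : B} {f : a ⟶ b} {g : b ⟶ a} (adj : f ⊣ g)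
    [IsIso (F.mapId a)] [IsIso (F.mapComp g f)] : F.map f ⊣ F.map g where
  unit := inv (F.mapId a) ≫ F.map₂ adj.unit ≫ F.mapComp f g
  counit := inv (F.mapComp g f) ≫ F.map₂ adj.counit ≫ F.mapId b
  left_triangle := by
    have h := adj.left_triangle
    rw [leftZigzag_eq] at h
    have : IsIso (F.mapComp (𝟙 a) f ≫ F.mapId a ▷ F.map f) := by
      rw [F.mapComp_id_left]; infer_instance
    -- Precomposing with the invertible unit comparison cancels the inverse in the unit and lets the
    -- triangle be gathered into the image of a single 2-cell of `B`.
    rw [leftZigzag_eq, ← cancel_epi (F.mapComp (𝟙 a) f ≫ F.mapId a ▷ F.map f)]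
    have e₁ : F.mapId a ▷ F.map f ≫ inv (F.mapId a) ▷ F.map f = 𝟙 _ := by
      rw [← comp_whiskerRight, IsIso.hom_inv_id, id_whiskerRight]
    have e₂ : F.map f ◁ F.mapComp g f ≫ F.map f ◁ inv (F.mapComp g f) = 𝟙 _ := by
      rw [← whiskerLeft_comp, IsIso.hom_inv_id, whiskerLeft_id]
    calc
      _ = F.mapComp (𝟙 a) f ≫ F.map₂ adj.unit ▷ F.map f ≫ F.mapComp f g ▷ F.map f ≫
          (α_ _ _ _).hom ≫ F.map f ◁ inv (F.mapComp g f) ≫ F.map f ◁ F.map₂ adj.counit ≫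
          F.map f ◁ F.mapId b := by
        simp only [comp_whiskerRight, whiskerLeft_comp, Category.assoc]
        rw [reassoc_of% e₁]
      _ = F.map₂ (adj.unit ▷ f ≫ (α_ _ _ _).hom ≫ f ◁ adj.counit) ≫ F.mapComp f (𝟙 b) ≫
          F.map f ◁ F.mapId b := by
        rw [← F.mapComp_naturality_left_assoc, ← F.map₂_associator_assoc, reassoc_of% e₂,
          ← F.mapComp_naturality_right_assoc, F.map₂_comp, F.map₂_comp, Category.assoc,
          Category.assoc]
      _ = _ := by
        rw [h, F.mapComp_id_right, F.mapComp_id_left, ← F.map₂_comp_assoc]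
        simp
  right_triangle := by
    have h := adj.right_triangle
    rw [rightZigzag_eq] at h
    have : IsIso (F.mapComp g (𝟙 a) ≫ F.map g ◁ F.mapId a) := by
      rw [F.mapComp_id_right]; infer_instance
    rw [rightZigzag_eq, ← cancel_epi (F.mapComp g (𝟙 a) ≫ F.map g ◁ F.mapId a)]
    have e₁ : F.map g ◁ F.mapId a ≫ F.map g ◁ inv (F.mapId a) = 𝟙 _ := by
      rw [← whiskerLeft_comp, IsIso.hom_inv_id, whiskerLeft_id]
    have e₂ : F.mapComp g f ▷ F.map g ≫ inv (F.mapComp g f) ▷ F.map g = 𝟙 _ := by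
      rw [← comp_whiskerRight, IsIso.hom_inv_id, id_whiskerRight]
    calc
      _ = F.mapComp g (𝟙 a) ≫ F.map g ◁ F.map₂ adj.unit ≫ F.map g ◁ F.mapComp f g ≫
          (α_ _ _ _).inv ≫ inv (F.mapComp g f) ▷ F.map g ≫ F.map₂ adj.counit ▷ F.map g ≫
          F.mapId b ▷ F.map g := by
        simp only [comp_whiskerRight, whiskerLeft_comp, Category.assoc]
        rw [reassoc_of% e₁]
      _ = F.map₂ (g ◁ adj.unit ≫ (α_ _ _ _).inv ≫ adj.counit ▷ g) ≫ F.mapComp (𝟙 b) g ≫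
          F.mapId b ▷ F.map g := by
        rw [← F.mapComp_naturality_right_assoc, F.mapComp_assoc_right_assoc,
          Iso.hom_inv_id_assoc, reassoc_of% e₂,
          ← F.mapComp_naturality_left_assoc, F.map₂_comp, F.map₂_comp, Category.assoc,
          Category.assoc]
      _ = _ := by
        rw [h, F.mapComp_id_right, F.mapComp_id_left, ← F.map₂_comp_assoc]
        simp

lemma oplaxMapAdj_unit (F : B ⥤ᵒᵖᴸ C) {a b : B} {f : a ⟶ b} {g : b ⟶ a} (adj : f ⊣ g)
    [IsIso (F.mapId a)] [IsIso (F.mapComp g f)] :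
    (oplaxMapAdj F adj).unit = inv (F.mapId a) ≫ F.map₂ adj.unit ≫ F.mapComp f g :=
  rfl

lemma oplaxMapAdj_counit (F : B ⥤ᵒᵖᴸ C) {a b : B} {f : a ⟶ b} {g : b ⟶ a} (adj : f ⊣ g)
    [IsIso (F.mapId a)] [IsIso (F.mapComp g f)] :
    (oplaxMapAdj F adj).counit = inv (F.mapComp g f) ≫ F.map₂ adj.counit ≫ F.mapId b :=
  rfl

end OplaxAdj

/-! ### Cells in the bicategory of spans -/

noncomputable section SpanCells

variable {E : Type u} [Category.{v} E] [PullbackChoice E]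

namespace Sp

variable {A A' X Y Z : E}

/-- The 2-cell of spans given by a morphism `a` into the apex of `S`. -/
@[simps]
def cell (S : Sp X Y) (a : A ⟶ S.apex) {x : A ⟶ X} {y : A ⟶ Y} (hx : a ≫ S.l = x)
    (hy : a ≫ S.r = y) : Sp.mk (𝟙 A) y ⟶ (Sp.mk (𝟙 A) x).comp S where
  hom := plift (𝟙 A) a (by simp [hx])
  hom_l := by simp
  hom_r := by simp [hy]

/-- This and the next three lemmas are the axioms of an extension for the identity of the bicategory
of spans. An oplax functor then transports them to its target. -/
lemma restr_cell (S : Sp X Y) (c : A' ⟶ A) (a : A ⟶ S.apex) {a' : A' ⟶ S.apex}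
    (ha : c ≫ a = a') {x : A ⟶ X} {y : A ⟶ Y} {x' : A' ⟶ X} {y' : A' ⟶ Y}
    (hx : a ≫ S.l = x) (hy : a ≫ S.r = y) (hx' : a' ≫ S.l = x') (hy' : a' ≫ S.r = y')
    (hcx : c ≫ x = x') (hcy : c ≫ y = y') :
    (Sp.mk (𝟙 A) y).cell c (Category.comp_id c) hcy ≫
        whiskerLeft (Sp.mk (𝟙 A') c) (S.cell a hx hy) =
      S.cell a' hx' hy' ≫ whiskerRight ((Sp.mk (𝟙 A) x).cell c (Category.comp_id c) hcx) S ≫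
        (associator _ _ _).hom := by
  apply Span.hom_ext
  apply ChosenPullback.hom_ext
  · simp
  · apply ChosenPullback.hom_ext <;> simp [ha]

lemma cell_comp {S T : Sp X Y} (h : S ⟶ T) (a : A ⟶ S.apex) {a' : A ⟶ T.apex}
    (ha : a ≫ h.hom = a') {x : A ⟶ X} {y : A ⟶ Y} (hx : a ≫ S.l = x) (hy : a ≫ S.r = y)
    (hx' : a' ≫ T.l = x) (hy' : a' ≫ T.r = y) :
    S.cell a hx hy ≫ whiskerLeft (Sp.mk (𝟙 A) x) h = T.cell a' hx' hy' := by
  apply Span.hom_ext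
  apply ChosenPullback.hom_ext <;> simp [ha]

lemma comp_cell (S : Sp X Y) (T : Sp Y Z) (a : A ⟶ (S.comp T).apex)
    {a₁ : A ⟶ S.apex} {a₂ : A ⟶ T.apex} (ha₁ : a ≫ (pb S.r T.l).p₁ = a₁)
    (ha₂ : a ≫ (pb S.r T.l).p₂ = a₂) {x : A ⟶ X} {y : A ⟶ Y} {z : A ⟶ Z}
    (hx : a ≫ (S.comp T).l = x) (hz : a ≫ (S.comp T).r = z) (hx₁ : a₁ ≫ S.l = x)
    (hy₁ : a₁ ≫ S.r = y) (hy₂ : a₂ ≫ T.l = y) (hz₂ : a₂ ≫ T.r = z) :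
    (S.comp T).cell a hx hz ≫ (associator _ _ _).inv =
      T.cell a₂ hy₂ hz₂ ≫ whiskerRight (S.cell a₁ hx₁ hy₁) T := by
  apply Span.hom_ext
  apply ChosenPullback.hom_ext
  · apply ChosenPullback.hom_ext <;> simp [ha₁]
  · simp [ha₂]

lemma id_cell {X A : E} (a : A ⟶ X) {x : A ⟶ X} (hx : a ≫ 𝟙 X = x) :
    (Sp.mk (𝟙 X) (𝟙 X)).cell a hx hx ≫ (rightUnitor _).hom = 𝟙 _ := by
  apply Span.hom_ext
  simp

/-- A span as the composite of the spans given by its legs. -/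
def factorization (S : Sp X Y) : S ≅ (Sp.mk S.l (𝟙 S.apex)).comp (Sp.mk (𝟙 S.apex) S.r) :=
  Span.mkIso
    { hom := plift (𝟙 _) (𝟙 _) rfl
      inv := (pb (𝟙 S.apex) (𝟙 S.apex)).p₁
      hom_inv_id := by simp
      inv_hom_id := by apply ChosenPullback.hom_ext <;> simp [pb_id_p₁] }
    (by simp) (by simp)

@[simp]
lemma factorization_hom_hom (S : Sp X Y) :
    S.factorization.hom.hom = plift (𝟙 S.apex) (𝟙 S.apex) rfl :=
  rfl

end Sp

end SpanCells

/-! ### The extension given by a gregarious functor -/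

section Gregarious

variable {E : Type u} [Category.{v} E] {C : Type u₁} [Bicategory.{w₁, v₁} C]

lemma mapComp'_id_comp_mapId (P : LocallyDiscrete E ⥤ᵖ C) {a b : LocallyDiscrete E} (f : a ⟶ b) :
    (P.mapComp' (𝟙 a) f f).hom ≫ (P.mapId a).hom ▷ P.map f ≫ (λ_ _).hom = 𝟙 _ := by
  rw [P.mapComp'_id_comp_hom f]
  simp

lemma mapComp'_comp_id_mapId (P : LocallyDiscrete E ⥤ᵖ C) {a b : LocallyDiscrete E} (f : a ⟶ b) :
    (P.mapComp' f (𝟙 b) f).hom ≫ P.map f ◁ (P.mapId b).hom ≫ (ρ_ _).hom = 𝟙 _ := by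
  rw [P.mapComp'_comp_id_hom f]
  simp

/-- A pseudofunctor from a locally discrete bicategory, in terms of the underlying category. -/
def Base.ofPseudo (P : LocallyDiscrete E ⥤ᵖ C) : Base E C (fun X => P.obj ⟨X⟩) where
  map f := P.map f.toLoc
  mu {_ _ _ f g k} h := P.mapComp' f.toLoc g.toLoc k.toLoc (congrArg Quiver.Hom.toLoc h)
  unit X := P.mapId ⟨X⟩
  mu_assoc h₁ h₂ _ h₄ :=
    (P.mapComp'₀₁₃_hom_comp_whiskerLeft_mapComp'_hom _ _ _ _ _ _
      (congrArg Quiver.Hom.toLoc h₁) (congrArg Quiver.Hom.toLoc h₂)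
      (congrArg Quiver.Hom.toLoc h₄)).symm
  mu_id_left {_ _ f} _ := mapComp'_id_comp_mapId P f.toLoc
  mu_id_right {_ _ f} _ := mapComp'_comp_id_mapId P f.toLoc

variable [PullbackChoice E]

/-- The composite of a gregarious functor with `(-)_Σ`. -/
noncomputable def sigmaPseudo (G : Greg (SpanBicat E) C) : LocallyDiscrete E ⥤ᵖ C :=
  Pseudofunctor.mkOfOplax ((sigma E).toOplax.comp G.obj.fn)
    { mapIdIso := fun a =>
        have : IsIso (((sigma E).toOplax.comp G.obj.fn).mapId a) :=
          have := G.property.1 ((sigma E).obj a)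
          inferInstanceAs (IsIso (G.obj.fn.map₂ ((sigma E).mapId a).hom ≫ G.obj.fn.mapId _))
        asIso (((sigma E).toOplax.comp G.obj.fn).mapId a)
      mapCompIso := fun f g =>
        have : IsIso (((sigma E).toOplax.comp G.obj.fn).mapComp f g) :=
          have := G.property.2 ((sigma E).map f) ((sigma E).map g) (.mk (sigmaAdj g.as))
          inferInstanceAs (IsIso (G.obj.fn.map₂ ((sigma E).mapComp f g).hom ≫
            G.obj.fn.mapComp _ _))
        asIso (((sigma E).toOplax.comp G.obj.fn).mapComp f g) }

/-- A gregarious functor, restricted to the morphisms of `E`. -/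
noncomputable abbrev gregBase (G : Greg (SpanBicat E) C) : Base E C (fun X => G.obj.fn.obj ⟨X⟩) :=
  Base.ofPseudo (sigmaPseudo G)

end Gregarious

end SpanUP

namespace SpanUP

/-! ### The extension given by a gregarious functor -/

noncomputable section GregExtension

variable {E : Type u} [Category.{v} E] [PullbackChoice E] {C : Type u₁} [Bicategory.{w₁, v₁} C]

/-- The span `X ⟵ X ⟶ Y` with legs `𝟙` and `f`, as a 1-cell of the bicategory of spans. -/
abbrev sg {X Y : E} (f : X ⟶ Y) : (⟨X⟩ : SpanBicat E) ⟶ ⟨Y⟩ := Sp.mk (𝟙 X) f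

/-- A span as a 1-cell of the bicategory of spans. -/
abbrev Sp.toHom {X Y : E} (S : Sp X Y) : (⟨X⟩ : SpanBicat E) ⟶ ⟨Y⟩ := S

/-- A morphism of spans as a 2-cell of the bicategory of spans. -/
abbrev toHom₂ {X Y : E} {S T : Sp X Y} (h : S ⟶ T) : S.toHom ⟶ T.toHom := h

variable {A A' X Y Z : E}

/-- The 2-cell of spans given by a morphism `a` into the apex of `S`. -/
def sgCell (S : Sp X Y) (a : A ⟶ S.apex) {x : A ⟶ X} {y : A ⟶ Y}
    (hx : a ≫ S.l = x) (hy : a ≫ S.r = y) : sg y ⟶ sg x ≫ S.toHom :=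
  S.cell a hx hy

/-- The 2-cell `G (y_Σ) ⟶ G (x_Σ) ≫ G S` given by a morphism `a` into the apex of `S`. -/
def oplaxCell (G : SpanBicat E ⥤ᵒᵖᴸ C) (S : Sp X Y) (a : A ⟶ S.apex) {x : A ⟶ X} {y : A ⟶ Y}
    (hx : a ≫ S.l = x) (hy : a ≫ S.r = y) : G.map (sg y) ⟶ G.map (sg x) ≫ G.map S.toHom :=
  G.map₂ (sgCell S a hx hy) ≫ G.mapComp _ _

variable (G : SpanBicat E ⥤ᵒᵖᴸ C)

lemma oplaxCell_restr (S : Sp X Y) (c : A' ⟶ A) (a : A ⟶ S.apex) {a' : A' ⟶ S.apex}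
    (ha : c ≫ a = a') {x : A ⟶ X} {y : A ⟶ Y} {x' : A' ⟶ X} {y' : A' ⟶ Y}
    (hx : a ≫ S.l = x) (hy : a ≫ S.r = y) (hx' : a' ≫ S.l = x') (hy' : a' ≫ S.r = y')
    (hcx : c ≫ x = x') (hcy : c ≫ y = y') :
    oplaxCell G (Sp.mk (𝟙 A) y) c (Category.comp_id c) hcy ≫
        G.map (sg c) ◁ oplaxCell G S a hx hy =
      oplaxCell G S a' hx' hy' ≫
        oplaxCell G (Sp.mk (𝟙 A) x) c (Category.comp_id c) hcx ▷ G.map S.toHom ≫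
        (α_ _ _ _).hom := by
  have e : sgCell (Sp.mk (𝟙 A) y) c (Category.comp_id c) hcy ≫ sg c ◁ sgCell S a hx hy =
      sgCell S a' hx' hy' ≫ sgCell (Sp.mk (𝟙 A) x) c (Category.comp_id c) hcx ▷ S.toHom ≫
        (α_ (sg c) (sg x) S.toHom).hom :=
    S.restr_cell c a ha hx hy hx' hy' hcx hcy
  simp only [oplaxCell, whiskerLeft_comp, comp_whiskerRight, Category.assoc]
  rw [← G.mapComp_naturality_right_assoc, ← G.mapComp_naturality_left_assoc,
    ← G.map₂_comp_assoc, e, ← G.map₂_associator]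
  simp only [G.map₂_comp, Category.assoc]

lemma oplaxCell_map₂ {S T : Sp X Y} (h : S ⟶ T) (a : A ⟶ S.apex) {a' : A ⟶ T.apex}
    (ha : a ≫ h.hom = a') {x : A ⟶ X} {y : A ⟶ Y} (hx : a ≫ S.l = x) (hy : a ≫ S.r = y)
    (hx' : a' ≫ T.l = x) (hy' : a' ≫ T.r = y) :
    oplaxCell G S a hx hy ≫ G.map (sg x) ◁ G.map₂ (toHom₂ h) = oplaxCell G T a' hx' hy' := by
  have e : sgCell S a hx hy ≫ sg x ◁ toHom₂ h = sgCell T a' hx' hy' :=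
    Sp.cell_comp h a ha hx hy hx' hy'
  rw [oplaxCell, Category.assoc, ← G.mapComp_naturality_right, ← G.map₂_comp_assoc, e, oplaxCell]

lemma oplaxCell_mapComp (S : Sp X Y) (T : Sp Y Z) (a : A ⟶ (S.comp T).apex)
    {a₁ : A ⟶ S.apex} {a₂ : A ⟶ T.apex} (ha₁ : a ≫ (pb S.r T.l).p₁ = a₁)
    (ha₂ : a ≫ (pb S.r T.l).p₂ = a₂) {x : A ⟶ X} {y : A ⟶ Y} {z : A ⟶ Z}
    (hx : a ≫ (S.comp T).l = x) (hz : a ≫ (S.comp T).r = z) (hx₁ : a₁ ≫ S.l = x)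
    (hy₁ : a₁ ≫ S.r = y) (hy₂ : a₂ ≫ T.l = y) (hz₂ : a₂ ≫ T.r = z) :
    oplaxCell G (S.comp T) a hx hz ≫ G.map (sg x) ◁ G.mapComp S.toHom T.toHom =
      paste (oplaxCell G S a₁ hx₁ hy₁) (oplaxCell G T a₂ hy₂ hz₂) := by
  have e : sgCell (S.comp T) a hx hz ≫ (α_ (sg x) S.toHom T.toHom).inv =
      sgCell T a₂ hy₂ hz₂ ≫ sgCell S a₁ hx₁ hy₁ ▷ T.toHom :=
    S.comp_cell T a ha₁ ha₂ hx hz hx₁ hy₁ hy₂ hz₂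
  simp only [paste, oplaxCell, comp_whiskerRight, Category.assoc]
  rw [← G.mapComp_naturality_left_assoc, ← G.map₂_comp_assoc, ← e]
  erw [G.mapComp_assoc_right]
  rw [G.map₂_comp, Category.assoc]

lemma oplaxCell_mapId (a : A ⟶ X) {x : A ⟶ X} (hx : a ≫ 𝟙 X = x) :
    oplaxCell G (Sp.mk (𝟙 X) (𝟙 X)) a hx hx ≫ G.map (sg x) ◁ G.mapId ⟨X⟩ =
      (ρ_ (G.map (sg x))).inv := by
  have e : sgCell (Sp.mk (𝟙 X) (𝟙 X)) a hx hx ≫ (ρ_ (sg x)).hom = 𝟙 _ := Sp.id_cell a hx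
  rw [oplaxCell, Category.assoc]
  erw [G.mapComp_id_right]
  rw [← G.map₂_comp_assoc]
  erw [e]
  simp

section

variable (G : Greg (SpanBicat E) C)

lemma isIso_mapComp_sg {W : SpanBicat E} (S : W ⟶ ⟨X⟩) (f : X ⟶ Y) :
    IsIso (G.obj.fn.mapComp S (sg f)) :=
  G.property.2 S (sg f) (.mk (sigmaAdj f))

/-- The underlying 2-cell of spans is the invertible `sigmaComp a f`, and the constraint ends in the
left adjoint `f_Σ`. -/
lemma isIso_oplaxCell_sg (f : X ⟶ Y) (a : A ⟶ X) {y : A ⟶ Y} (hx : a ≫ 𝟙 X = a)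
    (hy : a ≫ f = y) : IsIso (oplaxCell G.obj.fn (Sp.mk (𝟙 X) f) a hx hy) := by
  have := isIso_mapComp_sg G (sg a) f
  have : IsIso (sgCell (Sp.mk (𝟙 X) f) a hx hy) := by
    subst hy
    exact (sigmaComp a f).isIso_hom
  rw [oplaxCell]
  infer_instance

/-- The adjunction between the values of a gregarious functor at the two spans given by `f`. -/
def gregAdj (f : X ⟶ Y) :
    G.obj.fn.map (sg f) ⊣ G.obj.fn.map (Sp.mk f (𝟙 X)).toHom :=
  have := G.property.1 ⟨X⟩
  have := isIso_mapComp_sg G (Sp.mk f (𝟙 X)).toHom f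
  oplaxMapAdj G.obj.fn (sigmaAdj f)

/-- Links the cell of a reversed span to the unit of an adjunction, from which its universality
follows. -/
lemma mapId_gregAdj_unit (f : X ⟶ Y) : G.obj.fn.mapId ⟨X⟩ ≫ (gregAdj G f).unit =
    oplaxCell G.obj.fn (Sp.mk f (𝟙 X)) (𝟙 X) (Category.id_comp f) (Category.id_comp _) := by
  have := G.property.1 ⟨X⟩
  have := isIso_mapComp_sg G (Sp.mk f (𝟙 X)).toHom f
  rw [gregAdj, oplaxMapAdj_unit, IsIso.hom_inv_id_assoc]
  rfl

lemma isUniv_oplaxCell (S : Sp X Y) : IsUniv (oplaxCell G.obj.fn S (𝟙 S.apex)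
    (Category.id_comp S.l) (Category.id_comp S.r)) := by
  let S₁ : Sp X S.apex := Sp.mk S.l (𝟙 S.apex)
  let S₂ : Sp S.apex Y := Sp.mk (𝟙 S.apex) S.r
  have h₀ := G.property.1 ⟨S.apex⟩
  have h₁ : IsUniv (oplaxCell G.obj.fn S₁ (𝟙 S.apex) (Category.id_comp S.l)
      (Category.id_comp _)) := by
    rw [← mapId_gregAdj_unit]
    exact (isUniv_unit _).isIso_comp _
  have : IsLeftAdjoint (G.obj.fn.map (sg S.l)) := .mk (gregAdj G S.l)
  have h₂ := isIso_oplaxCell_sg G S.r (𝟙 S.apex) (Category.comp_id _) (Category.id_comp S.r)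
  -- The cell of `S` is, up to the isomorphisms below, the pasting of the cell of the reversed span
  -- `S₁`, universal and absolute, with the invertible cell of `S₂`.
  have h₃ := (h₁.whiskerRight (G.obj.fn.map S₂.toHom)).isIso_comp (oplaxCell G.obj.fn S₂
    (𝟙 S.apex) (Category.comp_id _) (Category.id_comp S.r))
  have h₄ := isIso_mapComp_sg G S₁.toHom S.r
  have h₅ : IsIso (toHom₂ S.factorization.hom) := S.factorization.isIso_hom
  apply IsUniv.of_comp_isIso (G.obj.fn.map₂ (toHom₂ S.factorization.hom) ≫
    G.obj.fn.mapComp S₁.toHom S₂.toHom)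
  convert h₃ using 1
  rw [whiskerLeft_comp, ← Category.assoc, oplaxCell_map₂ _ S.factorization.hom (𝟙 _)
    (Category.id_comp _) _ _ (by simp) (by simp)]
  exact oplaxCell_mapComp G.obj.fn S₁ S₂ _ (by simp [S₁, S₂]) (by simp [S₁, S₂]) _ _ _ _ _ _

/-- The constraints of the restricted functor are themselves cells, so `oplaxCell_restr` becomes a
statement about `restr`. -/
lemma gregBase_mu_hom {f : X ⟶ Y} {g : Y ⟶ Z} {k : X ⟶ Z} (h : f ≫ g = k) :
    ((gregBase G).mu h).hom =
      oplaxCell G.obj.fn (Sp.mk (𝟙 Y) g) f (Category.comp_id f) h := by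
  subst h
  exact congrArg Iso.hom ((sigmaPseudo G).mapComp'_eq_mapComp f.toLoc g.toLoc)

/-- A gregarious functor as an extension of its restriction to the morphisms of `E`. -/
def gregExtension : Extension (gregBase G) where
  map S := G.obj.fn.map S.toHom
  map₂ h := G.obj.fn.map₂ (toHom₂ h)
  mapComp S T := G.obj.fn.mapComp S.toHom T.toHom
  mapId X := G.obj.fn.mapId ⟨X⟩
  cell S _ a _ _ hx hy := oplaxCell G.obj.fn S a hx hy
  restr_cell S _ _ c a _ ha _ _ _ _ hx hy hx' hy' hcx hcy := by
    have e := oplaxCell_restr G.obj.fn S c a ha hx hy hx' hy' hcx hcy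
    rw [← gregBase_mu_hom, ← gregBase_mu_hom] at e
    exact (gregBase G).restr_eq c hcx hcy e
  cell_map₂ h _ a _ ha _ _ hx hy hx' hy' := oplaxCell_map₂ G.obj.fn h a ha hx hy hx' hy'
  cell_mapComp S T _ a _ _ ha₁ ha₂ _ _ _ hx hz hx₁ hy₁ hy₂ hz₂ :=
    oplaxCell_mapComp G.obj.fn S T a ha₁ ha₂ hx hz hx₁ hy₁ hy₂ hz₂
  cell_mapId a _ hx := oplaxCell_mapId G.obj.fn a hx
  isUniv_cell S := isUniv_oplaxCell G S

end

end GregExtension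

end SpanUP

namespace SpanUP

/-! ### Invertible icons -/

section InvertibleIcons

variable {B : Type u₁} [Bicategory.{w₁, v₁} B] {C : Type u₂} [Bicategory.{w₂, v₂} C]

section Casts

variable {x' y' z' x y z : C}

/-- The inverse of a 2-cell into a 1-cell that is transported along equalities of objects. -/
noncomputable def castInv (hx : x = x') (hy : y = y') {f : x ⟶ y} {g : x' ⟶ y'}
    (α : f ⟶ (castHom hx hy).obj g) [hα : IsIso α] : g ⟶ (castHom hx.symm hy.symm).obj f := by
  subst hx hy
  exact @CategoryTheory.inv _ _ f g α hα

lemma castInv_naturality (hx : x = x') (hy : y = y') {f f₁ : x ⟶ y} {g g₁ : x' ⟶ y'}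
    (α : f ⟶ (castHom hx hy).obj g) [hα : IsIso α]
    (α₁ : f₁ ⟶ (castHom hx hy).obj g₁) [hα₁ : IsIso α₁]
    (φ : f ⟶ f₁) (ψ : g ⟶ g₁) (h : φ ≫ α₁ = α ≫ (castHom hx hy).map ψ) :
    ψ ≫ castInv hx hy α₁ = castInv hx hy α ≫ (castHom hx.symm hy.symm).map φ := by
  subst hx hy
  change f ⟶ g at α
  change f₁ ⟶ g₁ at α₁
  change φ ≫ α₁ = α ≫ ψ at h
  replace hα : @IsIso _ _ f g α := hα
  replace hα₁ : @IsIso _ _ f₁ g₁ α₁ := hα₁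
  change ψ ≫ inv α₁ = inv α ≫ φ
  rw [IsIso.comp_inv_eq, Category.assoc, h, IsIso.inv_hom_id_assoc]

lemma castInv_comp (hx : x = x') (hy : y = y') (hz : z = z')
    {f₁ : x ⟶ y} {f₂ : y ⟶ z} {f : x ⟶ z} (φ : f ⟶ f₁ ≫ f₂)
    {g₁ : x' ⟶ y'} {g₂ : y' ⟶ z'} {g : x' ⟶ z'} (ψ : g ⟶ g₁ ≫ g₂)
    (α₁ : f₁ ⟶ (castHom hx hy).obj g₁) (α₂ : f₂ ⟶ (castHom hy hz).obj g₂)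
    (α : f ⟶ (castHom hx hz).obj g) [hα₁ : IsIso α₁] [hα₂ : IsIso α₂] [hα : IsIso α]
    (h : α ≫ (castHom hx hz).map ψ = φ ≫ α₁ ▷ f₂ ≫ (castHom hx hy).obj g₁ ◁ α₂ ≫
      (castHomComp hx hy hz g₁ g₂).hom) :
    castInv hx hz α ≫ (castHom hx.symm hz.symm).map φ =
      ψ ≫ castInv hx hy α₁ ▷ g₂ ≫ (castHom hx.symm hy.symm).obj f₁ ◁ castInv hy hz α₂ ≫
        (castHomComp hx.symm hy.symm hz.symm f₁ f₂).hom := by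
  subst hx hy hz
  change f₁ ⟶ g₁ at α₁
  change f₂ ⟶ g₂ at α₂
  change f ⟶ g at α
  change α ≫ ψ = φ ≫ α₁ ▷ f₂ ≫ g₁ ◁ α₂ ≫ 𝟙 (g₁ ≫ g₂) at h
  replace hα : @IsIso _ _ f g α := hα
  replace hα₁ : @IsIso _ _ f₁ g₁ α₁ := hα₁
  replace hα₂ : @IsIso _ _ f₂ g₂ α₂ := hα₂
  change inv α ≫ φ = ψ ≫ inv α₁ ▷ g₂ ≫ f₁ ◁ inv α₂ ≫ 𝟙 (f₁ ≫ f₂)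
  rw [Category.comp_id] at h ⊢
  rw [IsIso.inv_comp_eq, reassoc_of% h, whisker_exchange_assoc, ← inv_whiskerRight,
    IsIso.hom_inv_id_assoc, ← inv_whiskerLeft]
  simp

lemma castInv_id (hx : x = x') {f : x ⟶ x} (φ : f ⟶ 𝟙 x) {g : x' ⟶ x'} (ψ : g ⟶ 𝟙 x')
    (α : f ⟶ (castHom hx hx).obj g) [hα : IsIso α]
    (h : α ≫ (castHom hx hx).map ψ ≫ (castHomId hx).hom = φ) :
    castInv hx hx α ≫ (castHom hx.symm hx.symm).map φ ≫ (castHomId hx.symm).hom = ψ := by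
  subst hx
  change f ⟶ g at α
  change α ≫ ψ ≫ 𝟙 _ = φ at h
  replace hα : @IsIso _ _ f g α := hα
  change inv α ≫ φ ≫ 𝟙 _ = ψ
  rw [← h]
  simp

lemma comp_castInv (hx : x = x') (hy : y = y') {f : x ⟶ y} {g : x' ⟶ y'}
    (α : f ⟶ (castHom hx hy).obj g) [hα : IsIso α] :
    α ≫ (castHom hx hy).map (castInv hx hy α) ≫
      (Icon.castHomTrans hx hx.symm hy hy.symm).hom.app f = 𝟙 f := by
  subst hx hy
  change f ⟶ g at α
  replace hα : @IsIso _ _ f g α := hα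
  change α ≫ inv α ≫ 𝟙 f = 𝟙 f
  simp

lemma castInv_comp_self (hx : x = x') (hy : y = y') {f : x ⟶ y} {g : x' ⟶ y'}
    (α : f ⟶ (castHom hx hy).obj g) [hα : IsIso α] :
    castInv hx hy α ≫ (castHom hx.symm hy.symm).map α ≫
      (Icon.castHomTrans hx.symm hx hy.symm hy).hom.app g = 𝟙 g := by
  subst hx hy
  change f ⟶ g at α
  replace hα : @IsIso _ _ f g α := hα
  change inv α ≫ α ≫ 𝟙 g = 𝟙 g
  simp

lemma isIso_of_castHom (hx : x = x') (hx' : x' = x) (hy : y = y') (hy' : y' = y) {f : x ⟶ y}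
    {g : x' ⟶ y'} (α : f ⟶ (castHom hx hy).obj g) (β : g ⟶ (castHom hx' hy').obj f)
    (h : α ≫ (castHom hx hy).map β ≫ (Icon.castHomTrans hx hx' hy hy').hom.app f = 𝟙 f)
    (h' : β ≫ (castHom hx' hy').map α ≫ (Icon.castHomTrans hx' hx hy' hy).hom.app g = 𝟙 g) :
    IsIso α := by
  subst hx hy
  change f ⟶ g at α
  change g ⟶ f at β
  change α ≫ β ≫ 𝟙 f = 𝟙 f at h
  change β ≫ α ≫ 𝟙 g = 𝟙 g at h'
  have : @IsIso _ _ f g α := ⟨β, by simpa using h, by simpa using h'⟩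
  exact this

end Casts

namespace Icon

section Components

variable {F G : B ⥤ᵒᵖᴸ C} (α : Icon F G)

/-- The component of an icon at a 1-cell. -/
def cmp {a b : B} (f : a ⟶ b) :
    F.map f ⟶ (castHom (α.obj_eq a) (α.obj_eq b)).obj (G.map f) :=
  (α.app a b).app f

lemma cmp_naturality {a b : B} {f g : a ⟶ b} (φ : f ⟶ g) :
    F.map₂ φ ≫ α.cmp g = α.cmp f ≫ (castHom (α.obj_eq a) (α.obj_eq b)).map (G.map₂ φ) :=
  (α.app a b).naturality φ

lemma cmp_comp {a b c : B} (f : a ⟶ b) (g : b ⟶ c) :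
    α.cmp (f ≫ g) ≫ (castHom (α.obj_eq a) (α.obj_eq c)).map (G.mapComp f g) =
      F.mapComp f g ≫ α.cmp f ▷ F.map g ≫
        (castHom (α.obj_eq a) (α.obj_eq b)).obj (G.map f) ◁ α.cmp g ≫
        (castHomComp (α.obj_eq a) (α.obj_eq b) (α.obj_eq c) (G.map f) (G.map g)).hom :=
  α.app_comp f g

lemma cmp_id (a : B) :
    α.cmp (𝟙 a) ≫ (castHom (α.obj_eq a) (α.obj_eq a)).map (G.mapId a) ≫
      (castHomId (α.obj_eq a)).hom = F.mapId a :=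
  α.app_id a

lemma cmp_congr {α β : Icon F G} (h : α = β) {a b : B} (f : a ⟶ b) : α.cmp f = β.cmp f := by
  subst h
  rfl

end Components

variable {F G : OplaxIcon B C}

/-- The inverse of an icon with invertible components. -/
noncomputable def inverse (α : Icon F.fn G.fn)
    (hα : ∀ {a b : B} (f : a ⟶ b), IsIso (α.cmp f)) : Icon G.fn F.fn where
  obj_eq a := (α.obj_eq a).symm
  app a b :=
    { app := fun f => castInv (hα := hα f) (α.obj_eq a) (α.obj_eq b) (α.cmp f)
      naturality := fun f g φ =>
        castInv_naturality (hα := hα f) (hα₁ := hα g) _ _ _ _ _ _ (α.cmp_naturality φ) }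
  app_comp f g :=
    castInv_comp (hα := hα (f ≫ g)) (hα₁ := hα f) (hα₂ := hα g) _ _ _ _ _ _ _ _ (α.cmp_comp f g)
  app_id a := castInv_id (hα := hα (𝟙 a)) _ _ _ _ (α.cmp_id a)

/-- An icon with invertible components is invertible. -/
noncomputable def isoMk (α : F ⟶ G) (hα : ∀ {a b : B} (f : a ⟶ b), IsIso (Icon.cmp α f)) :
    F ≅ G where
  hom := α
  inv := inverse α hα
  hom_inv_id := Icon.ext_app fun _ _ f => comp_castInv (hα := hα f) _ _ _
  inv_hom_id := Icon.ext_app fun _ _ f => castInv_comp_self (hα := hα f) _ _ _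

lemma isIso_cmp (α : F ≅ G) {a b : B} (f : a ⟶ b) : IsIso (Icon.cmp α.hom f) :=
  isIso_of_castHom _ (Icon.obj_eq α.inv a) _ (Icon.obj_eq α.inv b) _ (Icon.cmp α.inv f)
    (cmp_congr α.hom_inv_id f) (cmp_congr α.inv_hom_id f)

end Icon

/-! ### Icons and adjunctions -/

/-- The inverse of `α` is the mate of `β`; compatibility with the units and counits reduces both
composites to triangle identities. -/
lemma isIso_of_adj {x y : C} {f g : x ⟶ y} {u v : y ⟶ x} (adj₁ : f ⊣ u) (adj₂ : g ⊣ v)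
    (α : f ⟶ g) (β : u ⟶ v) (h₁ : adj₁.unit ≫ α ▷ u ≫ g ◁ β = adj₂.unit)
    (h₂ : β ▷ f ≫ v ◁ α ≫ adj₂.counit = adj₁.counit) : IsIso α := by
  refine ⟨(λ_ g).inv ≫ adj₁.unit ▷ g ≫ (α_ _ _ _).hom ≫ f ◁ (β ▷ g ≫ adj₂.counit) ≫
    (ρ_ f).hom, ?_, ?_⟩
  · calc
      _ = 𝟙 _ ⊗≫ (𝟙 x ◁ α ≫ adj₁.unit ▷ g) ⊗≫ f ◁ (β ▷ g ≫ adj₂.counit) ⊗≫ 𝟙 _ := by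
        bicategory
      _ = 𝟙 _ ⊗≫ adj₁.unit ▷ f ⊗≫ f ◁ ((u ◁ α ≫ β ▷ g) ≫ adj₂.counit) ⊗≫ 𝟙 _ := by
        rw [whisker_exchange]; bicategory
      _ = 𝟙 _ ⊗≫ leftZigzag adj₁.unit adj₁.counit ⊗≫ 𝟙 _ := by
        rw [whisker_exchange, Category.assoc, h₂]; bicategory
      _ = _ := by rw [adj₁.left_triangle]; bicategory
  · calc
      _ = 𝟙 _ ⊗≫ adj₁.unit ▷ g ⊗≫ f ◁ β ▷ g ⊗≫ (f ◁ adj₂.counit ≫ α ▷ 𝟙 y) ⊗≫ 𝟙 _ := by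
        bicategory
      _ = 𝟙 _ ⊗≫ adj₁.unit ▷ g ⊗≫ (f ◁ β ≫ α ▷ v) ▷ g ⊗≫ g ◁ adj₂.counit ⊗≫ 𝟙 _ := by
        rw [whisker_exchange]; bicategory
      _ = 𝟙 _ ⊗≫ (adj₁.unit ≫ α ▷ u ≫ g ◁ β) ▷ g ⊗≫ g ◁ adj₂.counit ⊗≫ 𝟙 _ := by
        rw [whisker_exchange]; bicategory
      _ = 𝟙 _ ⊗≫ leftZigzag adj₂.unit adj₂.counit ⊗≫ 𝟙 _ := by
        rw [h₁]; bicategory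
      _ = _ := by rw [adj₂.left_triangle]; bicategory

lemma isIso_of_adj_castHom {x x' y y' : C} (hx : x = x') (hy : y = y') {f : x ⟶ y} {g : x' ⟶ y'}
    {u : y ⟶ x} {v : y' ⟶ x'} (adj₁ : f ⊣ u) (adj₂ : g ⊣ v) (α : f ⟶ (castHom hx hy).obj g)
    (β : u ⟶ (castHom hy hx).obj v)
    (h₁ : adj₁.unit ≫ α ▷ u ≫ (castHom hx hy).obj g ◁ β ≫ (castHomComp hx hy hx g v).hom =
      (castHomId hx).inv ≫ (castHom hx hx).map adj₂.unit)
    (h₂ : β ▷ f ≫ (castHom hy hx).obj v ◁ α ≫ (castHomComp hy hx hy v g).hom ≫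
      (castHom hy hy).map adj₂.counit ≫ (castHomId hy).hom = adj₁.counit) : IsIso α := by
  subst hx hy
  change f ⟶ g at α
  change u ⟶ v at β
  change adj₁.unit ≫ α ▷ u ≫ g ◁ β ≫ 𝟙 _ = 𝟙 _ ≫ adj₂.unit at h₁
  change β ▷ f ≫ v ◁ α ≫ 𝟙 _ ≫ adj₂.counit ≫ 𝟙 _ = adj₁.counit at h₂
  exact isIso_of_adj adj₁ adj₂ α β (by simpa using h₁) (by simpa using h₂)

/-- The component of an icon at a left adjoint is invertible if the two oplax functors preserve
the adjunction. -/
lemma Icon.isIso_cmp_of_adj {F G : B ⥤ᵒᵖᴸ C} (α : Icon F G) {a b : B} {f : a ⟶ b} {g : b ⟶ a}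
    (adj : f ⊣ g) [IsIso (F.mapId a)] [IsIso (F.mapComp g f)] [IsIso (G.mapId a)]
    [IsIso (G.mapComp g f)] : IsIso (α.cmp f) := by
  -- The component at the right adjoint supplies the mate; the icon axioms give compatibility with
  -- the transported unit and counit.
  refine isIso_of_adj_castHom (α.obj_eq a) (α.obj_eq b) (oplaxMapAdj F adj) (oplaxMapAdj G adj) _
    (α.cmp g) ?_ ?_
  · simp only [oplaxMapAdj_unit, Category.assoc, Functor.map_comp, Functor.map_inv]
    rw [← α.cmp_comp, reassoc_of% α.cmp_naturality adj.unit, IsIso.inv_comp_eq, ← α.cmp_id]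
    simp
  · simp only [oplaxMapAdj_counit, Functor.map_comp, Functor.map_inv, Category.assoc]
    rw [← α.cmp_id, reassoc_of% α.cmp_naturality adj.counit, ← cancel_epi (F.mapComp g f),
      ← reassoc_of% α.cmp_comp g f]
    simp

end InvertibleIcons

end SpanUP

namespace SpanUP

/-! ### Transferring extensions along isomorphisms -/

section Transfer

variable {E : Type u} [Category.{v} E] {C : Type u₁} [Bicategory.{w₁, v₁} C] {o : E → C}

/-- An invertible icon between pseudofunctors with the same object function. Compatibility with the
unit constraints is automatic. -/
structure Base.Iso (F F' : Base E C o) where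
  app {X Y : E} (f : X ⟶ Y) : F.map f ≅ F'.map f
  app_mu {X Y Z : E} {f : X ⟶ Y} {g : Y ⟶ Z} {k : X ⟶ Z} (h : f ≫ g = k) :
    (app k).hom ≫ (F'.mu h).hom =
      (F.mu h).hom ≫ (app f).hom ▷ F.map g ≫ F'.map f ◁ (app g).hom

namespace Base.Iso

variable {F F' : Base E C o} (β : Base.Iso F F') {A A' X Y Z : E} {x : A ⟶ X} {y : A ⟶ Y}
  {z : A ⟶ Z}

/-- The transfer of a 2-cell `F' y ⟶ F' x ≫ m` along an isomorphism `F ≅ F'`. -/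
def transfer {m : o X ⟶ o Y} (q : F'.map y ⟶ F'.map x ≫ m) : F.map y ⟶ F.map x ≫ m :=
  (β.app y).hom ≫ q ≫ (β.app x).inv ▷ m

lemma transfer_comp {m m' : o X ⟶ o Y} (q : F'.map y ⟶ F'.map x ≫ m) (θ : m ⟶ m') :
    β.transfer (q ≫ F'.map x ◁ θ) = β.transfer q ≫ F.map x ◁ θ := by
  simp [transfer, whisker_exchange]

lemma transfer_paste {m : o X ⟶ o Y} {n : o Y ⟶ o Z} (q : F'.map y ⟶ F'.map x ≫ m)
    (q' : F'.map z ⟶ F'.map y ≫ n) :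
    β.transfer (paste q q') = paste (β.transfer q) (β.transfer q') := by
  simp [transfer, paste]

lemma transfer_unit : β.transfer (ρ_ (F'.map x)).inv = (ρ_ (F.map x)).inv := by
  simp [transfer]

/-- Evaluates the comparison at `f_Σ`, whose cells in `gregExtension` are constraints, and so shows
that the induced icon restricts to the given one. -/
lemma transfer_mu {f : X ⟶ Y} {g : Y ⟶ Z} {k : X ⟶ Z} (h : f ≫ g = k) :
    β.transfer (F'.mu h).hom = (F.mu h).hom ≫ F.map f ◁ (β.app g).hom := by
  rw [transfer, reassoc_of% β.app_mu h, whisker_exchange, hom_inv_whiskerRight_assoc]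

/-- By interchange, the isomorphism at `c` from the target leg meets its inverse from the source leg
and cancels. -/
lemma transfer_restr (c : A' ⟶ A) {x' : A' ⟶ X} {y' : A' ⟶ Y} (hx : c ≫ x = x')
    (hy : c ≫ y = y') {m : o X ⟶ o Y} (q : F'.map y ⟶ F'.map x ≫ m) :
    β.transfer (F'.restr c hx hy q) = F.restr c hx hy (β.transfer q) := by
  have e : (F'.mu hx).inv ≫ (β.app x').inv =
      F'.map c ◁ (β.app x).inv ≫ (β.app c).inv ▷ F.map x ≫ (F.mu hx).inv := by
    rw [Iso.inv_comp_eq, ← cancel_epi (β.app x').hom, Iso.hom_inv_id,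
      reassoc_of% β.app_mu hx]
    simp
  simp only [transfer, restr, Category.assoc, ← comp_whiskerRight, e]
  rw [reassoc_of% β.app_mu hy]
  simp only [whiskerLeft_comp, comp_whiskerRight, Category.assoc]
  rw [← cancel_epi (F.mu hy).inv]
  simp only [Iso.inv_hom_id_assoc]
  calc
    _ = (β.app c).hom ▷ F.map y ≫ F'.map c ◁ (β.app y).hom ≫ F'.map c ◁ q ≫
        F'.map c ◁ (β.app x).inv ▷ m ≫ ((α_ _ _ _).inv ≫ (β.app c).inv ▷ F.map x ▷ m) ≫
        (F.mu hx).inv ▷ m := by simp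
    _ = (β.app c).hom ▷ F.map y ≫ F'.map c ◁ (β.app y).hom ≫ F'.map c ◁ q ≫
        (F'.map c ◁ (β.app x).inv ▷ m ≫ (β.app c).inv ▷ (F.map x ≫ m)) ≫ (α_ _ _ _).inv ≫
        (F.mu hx).inv ▷ m := by simp
    _ = _ := by
      simp only [Category.assoc]
      rw [whisker_exchange_assoc, whisker_exchange_assoc, whisker_exchange_assoc,
        hom_inv_whiskerRight_assoc]

end Base.Iso

namespace Extension

variable [PullbackChoice E] {F F₁ : Base E C o} (G : Extension F) (G₁ : Extension F₁)
  (β : Base.Iso F F₁)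

/-- The comparison between extensions of isomorphic pseudofunctors. -/
noncomputable def comparison {X Y : E} (S : Sp X Y) : G.map S ⟶ G₁.map S :=
  (G.isUniv_cell S).desc (β.transfer
    (G₁.cell S (𝟙 S.apex) (Category.id_comp S.l) (Category.id_comp S.r)))

/-- True by definition on the universal cell, and restriction commutes with transfer. -/
lemma cell_comparison {X Y : E} (S : Sp X Y) {A : E} (a : A ⟶ S.apex) {x : A ⟶ X} {y : A ⟶ Y}
    (hx : a ≫ S.l = x) (hy : a ≫ S.r = y) :
    G.cell S a hx hy ≫ F.map x ◁ G.comparison G₁ β S = β.transfer (G₁.cell S a hx hy) := by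
  rw [← G.restr_cell S a (𝟙 _) (Category.comp_id a) (Category.id_comp _) (Category.id_comp _)
    hx hy hx hy, ← F.restr_comp, comparison, IsUniv.fac, ← β.transfer_restr,
    G₁.restr_cell S a (𝟙 _) (Category.comp_id a) (Category.id_comp _) (Category.id_comp _)
    hx hy hx hy]

lemma comparison_naturality {X Y : E} {S T : Sp X Y} (h : S ⟶ T) :
    G.map₂ h ≫ G.comparison G₁ β T = G.comparison G₁ β S ≫ G₁.map₂ h := by
  apply G.hom_ext
  rw [whiskerLeft_comp, whiskerLeft_comp,
    G.cell_map₂_assoc h (𝟙 _) (a' := h.hom) (by simp) (hx' := by simp) (hy' := by simp),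
    cell_comparison, reassoc_of% cell_comparison, ← β.transfer_comp,
    G₁.cell_map₂ h (𝟙 _) (a' := h.hom) (by simp) (hx' := by simp) (hy' := by simp)]

lemma comparison_comp {X Y Z : E} (S : Sp X Y) (T : Sp Y Z) :
    G.comparison G₁ β (S.comp T) ≫ G₁.mapComp S T =
      G.mapComp S T ≫ G.comparison G₁ β S ▷ G.map T ≫ G₁.map S ◁ G.comparison G₁ β T := by
  apply G.hom_ext
  simp only [whiskerLeft_comp]
  rw [reassoc_of% cell_comparison, ← β.transfer_comp,
    G₁.cell_mapComp S T _ (a₁ := (pb S.r T.l).p₁) (a₂ := (pb S.r T.l).p₂)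
      (y := (pb S.r T.l).p) (by simp) (by simp) (hx₁ := by simp) (hy₁ := by simp)
      (hy₂ := by simp) (hz₂ := by simp),
    G.cell_mapComp_assoc S T _ (a₁ := (pb S.r T.l).p₁) (a₂ := (pb S.r T.l).p₂)
      (y := (pb S.r T.l).p) (by simp) (by simp) (hx₁ := by simp) (hy₁ := by simp)
      (hy₂ := by simp) (hz₂ := by simp),
    ← reassoc_of% paste_comp_left, cell_comparison, ← paste_comp_right, cell_comparison,
    β.transfer_paste]

lemma comparison_id (X : E) :
    G.comparison G₁ β (Sp.mk (𝟙 X) (𝟙 X)) ≫ G₁.mapId X = G.mapId X := by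
  apply G.hom_ext
  rw [whiskerLeft_comp, reassoc_of% cell_comparison, ← β.transfer_comp]
  erw [G.cell_mapId (𝟙 X) (Category.comp_id _), G₁.cell_mapId (𝟙 X) (Category.comp_id _)]
  exact β.transfer_unit

/-- The icon between extensions of isomorphic pseudofunctors. -/
noncomputable def icon : Icon G.toOplax G₁.toOplax where
  obj_eq _ := rfl
  app _ _ :=
    { app := fun S => G.comparison G₁ β S
      naturality := fun _ _ h => G.comparison_naturality G₁ β h }
  app_comp S T := by
    refine (G.comparison_comp G₁ β S T).trans ?_
    exact (congrArg (fun θ => G.mapComp S T ≫ G.comparison G₁ β S ▷ G.map T ≫ θ)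
      (Category.comp_id _)).symm
  app_id X :=
    (congrArg (fun θ => G.comparison G₁ β (Sp.mk (𝟙 X.as) (𝟙 X.as)) ≫ θ)
      (Category.comp_id (G₁.mapId X.as))).trans (G.comparison_id G₁ β X.as)

end Extension

end Transfer

end SpanUP

namespace SpanUP

/-! ### Restriction along `(-)_Σ` -/

noncomputable section Restriction

variable {E : Type u} [Category.{v} E] [PullbackChoice E] {C : Type u₁} [Bicategory.{w₁, v₁} C]

/-- The components of an icon between gregarious functors at the morphisms of `E` are
invertible. -/
lemma isIso_cmp_sg {F G : Greg (SpanBicat E) C} (α : Icon F.obj.fn G.obj.fn) {X Y : E}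
    (f : X ⟶ Y) : IsIso (α.cmp (sg f)) :=
  have := F.property.1 ⟨X⟩
  have := G.property.1 ⟨X⟩
  have := isIso_mapComp_sg F (Sp.mk f (𝟙 X)).toHom f
  have := isIso_mapComp_sg G (Sp.mk f (𝟙 X)).toHom f
  α.isIso_cmp_of_adj (sigmaAdj f)

/-- An isomorphism of oplax functors underlying sinister pseudofunctors, as a morphism. -/
def sinHomMk {P Q : Sin E C}
    (e : OplaxIcon.mk P.of.obj.toOplax ≅ OplaxIcon.mk Q.of.obj.toOplax) : P ⟶ Q :=
  CoreHom.mk ((IsSinister E C).isoMk (InducedCategory.isoMk e))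

variable (E C) in
/-- Restriction of gregarious functors along `(-)_Σ`. -/
def gregToSin : Greg (SpanBicat E) C ⥤ Sin E C where
  obj G := ⟨⟨sigmaPseudo G, fun f => .mk (gregAdj G f)⟩⟩
  map {F G} α := sinHomMk (P := ⟨⟨sigmaPseudo F, _⟩⟩) (Q := ⟨⟨sigmaPseudo G, _⟩⟩)
    (Icon.isoMk ((iconPrecomp (sigma E).toOplax).map α.hom)
      fun f => isIso_cmp_sg α.hom f.as)
  map_id _ := Core.hom_ext rfl
  map_comp _ _ := Core.hom_ext rfl

lemma gregToSin_comp_sinForget : gregToSin E C ⋙ sinForget E C =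
    (IsGregarious (SpanBicat E) C).ι ⋙ iconPrecomp (sigma E).toOplax :=
  rfl

/-- Ties the component at `S` to those at its legs: with the cell universal and the component at the
left leg invertible, it determines the former. -/
lemma oplaxCell_cmp {F G : SpanBicat E ⥤ᵒᵖᴸ C} (α : Icon F G) {A X Y : E} (S : Sp X Y)
    (a : A ⟶ S.apex) {x : A ⟶ X} {y : A ⟶ Y} (hx : a ≫ S.l = x) (hy : a ≫ S.r = y) :
    oplaxCell F S a hx hy ≫ F.map (sg x) ◁ α.cmp S.toHom ≫ α.cmp (sg x) ▷ _ ≫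
        (castHomComp _ _ _ _ _).hom =
      α.cmp (sg y) ≫ (castHom _ _).map (oplaxCell G S a hx hy) := by
  rw [whisker_exchange_assoc, oplaxCell, Category.assoc, ← α.cmp_comp,
    reassoc_of% α.cmp_naturality, oplaxCell, Functor.map_comp]

instance : (gregToSin E C).Faithful where
  map_injective {F G} α α' h := by
    have hs {X Y : E} (f : X ⟶ Y) : Icon.cmp α.hom (sg f) = Icon.cmp α'.hom (sg f) :=
      Icon.cmp_congr (congrArg (fun φ => φ.iso.hom.hom.hom) h) f.toLoc
    apply InducedCategory.Hom.ext
    refine Icon.ext_app fun X Y S => (isUniv_oplaxCell F S).hom_ext ?_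
    have := isIso_cmp_sg α.hom (Span.l S)
    have e := oplaxCell_cmp α.hom S (𝟙 _) (Category.id_comp S.l) (Category.id_comp S.r)
    have e' := oplaxCell_cmp α'.hom S (𝟙 _) (Category.id_comp S.l) (Category.id_comp S.r)
    rw [← hs, ← hs] at e'
    have e₁ := e.trans e'.symm
    simp only [← Category.assoc, cancel_mono] at e₁
    exact e₁

/-- An icon between the restrictions of gregarious functors that is invertible is the restriction
of an icon. -/
lemma exists_icon {F G : Greg (SpanBicat E) C}
    (β : Icon (sigmaPseudo F).toOplax (sigmaPseudo G).toOplax)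
    (hβ : ∀ {X Y : E} (f : X ⟶ Y), IsIso (β.cmp f.toLoc)) :
    ∃ α : Icon F.obj.fn G.obj.fn, ∀ {X Y : E} (f : X ⟶ Y), α.cmp (sg f) = β.cmp f.toLoc := by
  -- The object function of `G` must become a variable, so that the equality with that of `F` can be
  -- substituted and all transports along it disappear.
  obtain ⟨⟨⟨⟨⟨⟨oG, mG⟩, m₂G⟩, h₁, h₂⟩, mIG, mCG, h₃, h₄, h₅, h₆, h₇⟩⟩, hG⟩ := G
  have ho : F.obj.fn.obj = oG := funext fun X => β.obj_eq ⟨X.as⟩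
  subst ho
  let G : Greg (SpanBicat E) C :=
    ⟨⟨⟨⟨⟨⟨F.obj.fn.obj, mG⟩, m₂G⟩, h₁, h₂⟩, mIG, mCG, h₃, h₄, h₅, h₆, h₇⟩⟩, hG⟩
  let B : Base E C (fun X => F.obj.fn.obj ⟨X⟩) := gregBase G
  let X : Extension B := gregExtension G
  let b {X Y : E} (f : X ⟶ Y) : (gregBase F).map f ≅ B.map f :=
    @asIso _ _ ((gregBase F).map f) (B.map f) (β.cmp f.toLoc) (hβ f)
  have hb {X Y Z : E} {f : X ⟶ Y} {g : Y ⟶ Z} {k : X ⟶ Z} (h : f ≫ g = k) :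
      (b k).hom ≫ (B.mu h).hom =
        ((gregBase F).mu h).hom ≫ (b f).hom ▷ (gregBase F).map g ≫ B.map f ◁ (b g).hom := by
    subst h
    have e := β.cmp_comp f.toLoc g.toLoc
    have e₁ : ((gregBase F).mu (rfl : f ≫ g = f ≫ g)).hom =
        (sigmaPseudo F).toOplax.mapComp f.toLoc g.toLoc :=
      congrArg Iso.hom ((sigmaPseudo F).mapComp'_eq_mapComp f.toLoc g.toLoc)
    have e₂ : ((gregBase G).mu (rfl : f ≫ g = f ≫ g)).hom =
        (sigmaPseudo G).toOplax.mapComp f.toLoc g.toLoc :=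
      congrArg Iso.hom ((sigmaPseudo G).mapComp'_eq_mapComp f.toLoc g.toLoc)
    rw [e₁]
    refine (congrArg ((b (f ≫ g)).hom ≫ ·) e₂).trans (e.trans ?_)
    exact congrArg (fun θ => (sigmaPseudo F).toOplax.mapComp f.toLoc g.toLoc ≫
      (b f).hom ▷ (gregBase F).map g ≫ θ) (Category.comp_id (B.map f ◁ (b g).hom))
  let c : Base.Iso (gregBase F) B := ⟨b, hb⟩
  -- At `f_Σ` the components are compared on a universal cell, which is the constraint of `𝟙 ≫ f =
  -- f`.
  refine ⟨(gregExtension F).icon X c, fun {Y Z} f => (isUniv_oplaxCell F (sg f)).hom_ext ?_⟩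
  refine ((gregExtension F).cell_comparison X c (Sp.mk (𝟙 Y) f) (𝟙 Y) (Category.id_comp _)
    (Category.id_comp _)).trans ?_
  have e₁ := gregBase_mu_hom F (Category.id_comp f)
  have e₂ : (B.mu (Category.id_comp f)).hom =
      X.cell (Sp.mk (𝟙 Y) f) (𝟙 Y) (Category.id_comp _) (Category.id_comp _) :=
    gregBase_mu_hom G (Category.id_comp f)
  rw [← e₂]
  refine (c.transfer_mu (Category.id_comp f)).trans ?_
  rw [e₁]
  rfl

instance : (gregToSin E C).Full where
  map_surjective {F G} β := by
    obtain ⟨α, hα⟩ := exists_icon (F := F) (G := G) β.iso.hom.hom.hom fun {X Y} f =>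
      Icon.isIso_cmp ((IsSinister E C ).ι ⋙ inducedFunctor _ |>.mapIso β.iso) f.toLoc
    exact ⟨ObjectProperty.homMk α, Core.hom_ext (InducedCategory.Hom.ext
      (InducedCategory.Hom.ext (Icon.ext_app fun _ _ f => hα f.as)))⟩

end Restriction

end SpanUP

namespace SpanUP

/-! ### The Beck cell -/

section BeckCell

variable {E : Type u} [Category.{v} E] {C : Type u₁} [Bicategory.{w₁, v₁} C]

/-- A mate is a transpose in two steps; `beck` is the result of the first, and `isUniv_iff` treats
the second. -/
lemma isIso_beckCell_iff (P : LocallyDiscrete E ⥤ᵖ C) {T X Y Z : E} {f' : T ⟶ X} {g' : T ⟶ Y}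
    {g : X ⟶ Z} {f : Y ⟶ Z} {y : T ⟶ Z} (sq : CommSq f' g' g f) (h₁ : f' ≫ g = y)
    (h₂ : g' ≫ f = y) {r' : P.obj ⟨Y⟩ ⟶ P.obj ⟨T⟩} {r : P.obj ⟨Z⟩ ⟶ P.obj ⟨X⟩}
    (adj' : P.map g'.toLoc ⊣ r') (adj : P.map g.toLoc ⊣ r) :
    IsIso (beckCell P sq adj' adj) ↔ IsUniv ((Base.ofPseudo P).beck h₁ h₂ adj) := by
  refine Iff.trans (iff_of_eq (congrArg _ ?_)) (isUniv_iff adj' _).symm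
  have e := P.isoMapOfCommSq_eq sq.toLoc y.toLoc (congrArg Quiver.Hom.toLoc h₁)
  exact (Bicategory.mateEquiv_apply adj' adj _).trans (congrArg (fun i =>
    adj'.homEquiv₁ (adj.homEquiv₂ (Iso.hom i) ≫ (α_ _ _ _).hom)) e)

end BeckCell

/-! ### Extension of sinister pseudofunctors to spans -/

noncomputable section EssSurj

variable {E : Type u} [Category.{v} E] [PullbackChoice E] {C : Type u₁} [Bicategory.{w₁, v₁} C]

namespace Extension

section

variable {o : E → C} {F : Base E C o} (G : Extension F)

lemma sigmaCell_comp {X Y : E} (f : X ⟶ Y) {m : o X ⟶ o Y} (θ : G.map (Sp.mk (𝟙 X) f) ⟶ m) :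
    G.sigmaCell f ≫ θ =
      (G.cell (Sp.mk (𝟙 X) f) (𝟙 X) (Category.id_comp _) (Category.id_comp _) ≫
        F.map (𝟙 X) ◁ θ) ≫ (F.unit X).hom ▷ m ≫ (λ_ m).hom := by
  rw [sigmaCell, Category.assoc, Category.assoc, Category.assoc, ← leftUnitor_naturality,
    ← whisker_exchange_assoc]

/-- The comparison `sigmaComp f g` is the generalized element `(𝟙, f)` of the pullback, so the left
side is the pasting of the cell of `f_Σ` at `𝟙` with that of `g_Σ` at `f`. -/
lemma sigmaCell_mapComp {X Y Z : E} (f : X ⟶ Y) (g : Y ⟶ Z) :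
    G.sigmaCell (f ≫ g) ≫ G.map₂ (sigmaComp f g).hom ≫
        G.mapComp (Sp.mk (𝟙 X) f) (Sp.mk (𝟙 Y) g) =
      (F.mu rfl).hom ≫ G.sigmaCell f ▷ F.map g ≫ G.map (Sp.mk (𝟙 X) f) ◁ G.sigmaCell g := by
  rw [sigmaCell_comp, whiskerLeft_comp,
    G.cell_map₂_assoc (sigmaComp f g).hom (𝟙 X) (a' := plift (𝟙 X) f (by simp)) (by simp)
      (hx' := by simp) (hy' := by simp),
    G.cell_mapComp (Sp.mk (𝟙 X) f) (Sp.mk (𝟙 Y) g) _ (a₁ := 𝟙 X) (a₂ := f) (y := f)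
      (by simp) (by simp) (hx₁ := by simp) (hy₁ := by simp) (hy₂ := by simp) (hz₂ := rfl),
    G.cell_sigma g f (Category.comp_id f) rfl, paste, ← whisker_exchange]
  have e : G.sigmaCell f ▷ G.map (Sp.mk (𝟙 Y) g) =
      G.cell (Sp.mk (𝟙 X) f) (𝟙 X) (Category.id_comp _) (Category.id_comp _) ▷ _ ≫
        (F.unit X).hom ▷ _ ▷ _ ≫ (λ_ _).hom ▷ _ := by
    rw [sigmaCell, comp_whiskerRight, comp_whiskerRight]
  rw [e]
  simp

lemma sigmaCell_mapId (X : E) : G.sigmaCell (𝟙 X) ≫ G.mapId X = (F.unit X).hom := by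
  rw [sigmaCell_comp, G.cell_mapId (𝟙 X) (Category.comp_id _)]
  simp

end

variable {P : LocallyDiscrete E ⥤ᵖ C} (G : Extension (Base.ofPseudo P))

/-- The comparison of a pseudofunctor with the restriction of its extension. -/
def sigmaIcon : Icon P.toOplax ((sigma E).toOplax.comp G.toOplax) where
  obj_eq _ := rfl
  app X Y :=
    { app := fun f => G.sigmaCell f.as
      naturality := fun f g η => by
        obtain rfl := LocallyDiscrete.eq_of_hom η
        obtain rfl : η = 𝟙 f := Subsingleton.elim _ _
        refine (congrArg (· ≫ G.sigmaCell f.as)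
          (CategoryTheory.Functor.map_id (P.toOplax.mapFunctor X Y) f)).trans ?_
        refine (Category.id_comp _).trans (Eq.trans (Category.comp_id _).symm ?_)
        exact congrArg (G.sigmaCell f.as ≫ ·) (CategoryTheory.Functor.map_id
          (((sigma E).toOplax.comp G.toOplax).mapFunctor X Y) f).symm }
  app_comp {X Y Z} f g := by
    have e := G.sigmaCell_mapComp f.as g.as
    have e₁ : ((Base.ofPseudo P).mu (rfl : f.as ≫ g.as = f.as ≫ g.as)).hom =
        P.toOplax.mapComp f g :=
      congrArg Iso.hom (P.mapComp'_eq_mapComp f g)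
    rw [e₁] at e
    exact e.trans (congrArg (fun θ => P.toOplax.mapComp f g ≫ G.sigmaCell f.as ▷ P.map g ≫ θ)
      (Category.comp_id _).symm)
  app_id X := by
    have e₁ : G.toOplax.map₂ (𝟙 (Sp.mk (𝟙 X.as) (𝟙 X.as)).toHom) ≫ G.mapId X.as =
        G.mapId X.as := by
      rw [G.toOplax.map₂_id]
      exact Category.id_comp _
    refine (congrArg (G.sigmaCell (𝟙 X.as) ≫ ·) ((Category.comp_id _).trans e₁)).trans ?_
    exact G.sigmaCell_mapId X.as

end Extension

/-- The extension of a sinister pseudofunctor to spans. -/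
def sinExtension (P : LocallyDiscrete E ⥤ᵖ C)
    (hP : ∀ {X Y : E} (f : X ⟶ Y), IsLeftAdjoint (P.map f.toLoc)) :
    Extension (Base.ofPseudo P) :=
  have {X Y : E} (f : X ⟶ Y) : IsLeftAdjoint ((Base.ofPseudo P).map f) := hP f
  Extension.ofSinister _

/-- The extension of a sinister pseudofunctor to a gregarious functor on spans. -/
def sinToGreg (P : Sin E C) : Greg (SpanBicat E) C :=
  have {X Y : E} (f : X ⟶ Y) : IsLeftAdjoint ((Base.ofPseudo P.of.obj).map f) := P.of.property f
  ⟨⟨(sinExtension P.of.obj P.of.property).toOplax⟩,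
    fun X => (sinExtension P.of.obj P.of.property).isIso_mapId X.as,
    fun S T hT => have := isIso_l_of_isLeftAdjoint T hT
      (sinExtension P.of.obj P.of.property).isIso_mapComp_of_isIso S T⟩

/-- A sinister pseudofunctor is the restriction of its extension to spans. -/
def sinToGregIso (P : Sin E C) : P ≅ (gregToSin E C).obj (sinToGreg P) :=
  Core.isoMk ((IsSinister E C).isoMk (InducedCategory.isoMk (Icon.isoMk
    (F := OplaxIcon.mk P.of.obj.toOplax)
    (G := OplaxIcon.mk (sigmaPseudo (sinToGreg P)).toOplax)
    (Extension.sigmaIcon (sinExtension P.of.obj P.of.property))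
    fun f => Extension.isIso_sigmaCell _ f.as)))

instance : (gregToSin E C).EssSurj where
  mem_essImage P := ⟨sinToGreg P, ⟨(sinToGregIso P).symm⟩⟩

instance : (gregToSin E C).IsEquivalence where

/-! ### The Beck condition -/

lemma beckCondition_sigmaPseudo (F : SpanBicat E ⥤ᵖ C) :
    BeckCondition (sigmaPseudo ((psToGreg _ C).obj F)) := by
  intro T X Y Z f' g' g f sq r' r adj' adj
  rw [isIso_beckCell_iff _ _ rfl sq.w.symm]
  have : IsIso ((gregExtension ((psToGreg _ C).obj F)).mapComp (Sp.mk (𝟙 Y) f)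
      (Sp.mk g (𝟙 X))) := (F.mapComp _ _).isIso_hom
  exact (gregExtension ((psToGreg _ C).obj F)).isUniv_beck sq _ _ adj

lemma isIso_mapComp_of_beckCondition (P : Sin E C) (hP : BeckCondition P.of.obj)
    {X Y Z : SpanBicat E} (S : X ⟶ Y) (T : Y ⟶ Z) : IsIso ((sinToGreg P).obj.fn.mapComp S T) := by
  have {X Y : E} (f : X ⟶ Y) : IsLeftAdjoint ((Base.ofPseudo P.of.obj).map f) := P.of.property f
  refine (sinExtension P.of.obj P.of.property).isIso_mapComp_of_beck S T
    (Adjunction.ofIsLeftAdjoint _) ?_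
  -- Flipped, since the adjoints in the Beck condition belong to the left leg of `T` and the
  -- projection to `S`.
  have sq := (pb (Span.r S) (Span.l T)).isPullback.flip
  exact (isIso_beckCell_iff P.of.obj sq.toCommSq _ _ (Adjunction.ofIsLeftAdjoint
    ((Base.ofPseudo P.of.obj).map (pb (Span.r S) (Span.l T)).p₁)) _).1 (hP sq _ _)

variable (E C) in
/-- Restriction of pseudofunctors along `(-)_Σ`. -/
def psToBeck : PsIcon (SpanBicat E) C ⥤ Beck E C :=
  (IsBeck E C).lift (psToGreg _ C ⋙ gregToSin E C) beckCondition_sigmaPseudo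

/-- The extension to a pseudofunctor on spans of a sinister pseudofunctor that satisfies the Beck
condition. -/
def beckToPs (P : Beck E C) : PsIcon (SpanBicat E) C :=
  have := (sinToGreg P.obj).property.1
  have {X Y Z : SpanBicat E} := isIso_mapComp_of_beckCondition P.obj P.property (X := X) (Y := Y)
    (Z := Z)
  Pseudofunctor.mkOfOplax' (sinToGreg P.obj).obj.fn

/-- A pseudofunctor that satisfies the Beck condition is the restriction of its extension to
spans. -/
def beckToPsIso (P : Beck E C) : P ≅ (psToBeck E C).obj (beckToPs P) :=
  -- Inverting the constraints does not change the underlying oplax functor, so the isomorphism for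
  -- the gregarious extension serves again.
  (IsBeck E C).isoMk (sinToGregIso P.obj)

instance : (psToGreg (SpanBicat E) C).Full :=
  Functor.Full.of_comp_faithful_iso (G := (IsGregarious (SpanBicat E) C).ι)
    (H := inducedFunctor fun F : SpanBicat E ⥤ᵖ C => OplaxIcon.mk F.toOplax) (Iso.refl _)

instance : (psToGreg (SpanBicat E) C).Faithful :=
  Functor.Faithful.of_comp_iso (G := (IsGregarious (SpanBicat E) C).ι)
    (H := inducedFunctor fun F : SpanBicat E ⥤ᵖ C => OplaxIcon.mk F.toOplax) (Iso.refl _)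

instance : (psToBeck E C).IsEquivalence where
  faithful := Functor.Faithful.of_comp_iso (G := (IsBeck E C).ι)
    (H := psToGreg _ C ⋙ gregToSin E C) (Iso.refl _)
  full := Functor.Full.of_comp_faithful_iso (G := (IsBeck E C).ι)
    (H := psToGreg _ C ⋙ gregToSin E C) (Iso.refl _)
  essSurj := ⟨fun P => ⟨beckToPs P, ⟨(beckToPsIso P).symm⟩⟩⟩

end EssSurj

end SpanUP

theorem theorem3 {E : Type u} [Category.{v} E] [PullbackChoice E]
    {C : Type u₁} [Bicategory.{w₁, v₁} C] :
    ∃ (Φ : Greg (SpanBicat E) C ⥤ Sin E C) (Ψ : PsIcon (SpanBicat E) C ⥤ Beck E C),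
      Φ ⋙ sinForget E C =
        (IsGregarious (SpanBicat E) C).ι ⋙ iconPrecomp (sigma E).toOplax ∧
      Φ.IsEquivalence ∧
      Ψ ⋙ (IsBeck E C).ι = psToGreg (SpanBicat E) C ⋙ Φ ∧
      Ψ.IsEquivalence := by
  exact ⟨gregToSin E C, psToBeck E C, gregToSin_comp_sinForget, inferInstance, rfl, inferInstance⟩
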